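/- All functions live on $(0,\infty)$. For $k\ge 0$ let $L^1_k$ be the space of (classes of) functions $g$ with $\|g\|_{L^1_k}=\int_0^\infty |g(x)|(1+x)^k\,dx<\infty$. Put $$\mathcal C(g,g)(x)=\int_0^x g(x-y)g(y)\,dy-2g(x)\int_0^\infty g(y)\,dy,\qquad (S_th)(x)=e^{2t}h(e^tx).$$ A (mild) solution, with initial condition $f_0\in L^1_k$, of Smoluchowski's equation in self-similar variables with constant kernel $K=2$, $$\partial_t f=\mathcal C(f,f)+2f+x\,\partial_xf,$$ is a function $f\in C([0,\infty);L^1_k)$ such that $f(t)=S_tf_0+\int_0^tS_{t-s}\,\mathcal C(f(s),f(s))\,ds$ for all $t\ge0$ (Bochner integral in $L^1_k$). **Theorem.** (i) The function $G^0(x)=e^{-x}$ is the unique nonnegative stationary solution $G\in L^1_1$ of this equation (that is, the constant curve $t\mapsto G$ is a solution in $C([0,\infty);L^1_1)$) with total mass $\int_0^\infty xG(x)\,dx=1$. (ii) There is a function $C=C(a,b)>0$ of $a,b\ge 0$, nondecreasing in each variable and explicit, in the sense that it is given by a closed formula built from $a$, $b$ and rational numbers by addition, multiplication, inversion, maximum,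 exponential and logarithm, with the following property. Let $k\ge0$ and let $f\in C([0,\infty);L^1_k)$ be a solution whose initial condition $f_0$ is nonnegative, has total mass $\int_0^\infty xf_0(x)\,dx=1$ and satisfies $f_0\in L^2(dx)\cap L^1(x^2\,dx)$. Then $$\|f(t,\cdot)-G^0\|_{L^2(0,\infty)}\le C\bigl(\|f_0\|_{L^2},\|f_0\|_{L^1_2}\bigr)\,e^{-t/2}\qquad\text{for all }t\ge0.$$ -/

import Mathlib

open MeasureTheory Set

noncomputable section

/-- Lebesgue measure on the half line `(0, ∞)`. -/
def halfLine : Measure ℝ := volume.restrict (Ioi 0)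

/-- The measure `(1 + x)^k dx` on `(0, ∞)`. -/
def weightMeasure (k : ℝ) : Measure ℝ :=
  halfLine.withDensity (fun x => ENNReal.ofReal ((1 + x) ^ k))

/-- The Banach space `L¹_k = L¹((0, ∞), (1 + x)^k dx)`. -/
abbrev WeightedL1 (k : ℝ) : Type := Lp ℝ 1 (weightMeasure k)

/-- The coagulation operator with kernel `K`:
`C_K(g,g)(x) = ½ ∫₀ˣ K(x-y,y) g(x-y) g(y) dy - g(x) ∫₀^∞ K(x,y) g(y) dy`. -/
def coagulation (K : ℝ → ℝ → ℝ) (g : ℝ → ℝ) (x : ℝ) : ℝ :=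
  (1 / 2) * (∫ y in (0 : ℝ)..x, K (x - y) y * g (x - y) * g y)
    - g x * ∫ y in Ioi (0 : ℝ), K x y * g y

/-- The semigroup generated by `h ↦ 2 h + x h'`, that is `(S_t h)(x) = e^{2t} h(e^t x)`. -/
def dilation (t : ℝ) (h : ℝ → ℝ) (x : ℝ) : ℝ :=
  Real.exp (2 * t) * h (Real.exp t * x)

/-- Mild solutions in `C([0, ∞), L¹_k)`, with initial datum `f₀`, of the Smoluchowski equation in
self-similar variables `∂ₜ f = C_K(f,f) + 2 f + x ∂ₓ f`:
`f(t) = S_t f₀ + ∫₀ᵗ S_{t-s} C_K(f(s),f(s)) ds` for all `t ≥ 0`, where the integral is the Bochner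
integral in `L¹_k` of the curve `Φ`, `Φ s` being the class of `S_{t-s} C_K(f(s),f(s))`. -/
structure IsMildSolution (K : ℝ → ℝ → ℝ) {k : ℝ} (f₀ : WeightedL1 k) (f : ℝ → WeightedL1 k) :
    Prop where
  continuousOn : ContinuousOn f (Ici 0)
  duhamel : ∀ t : ℝ, 0 ≤ t → ∃ Φ : ℝ → WeightedL1 k,
    (∀ s ∈ Icc 0 t, Φ s =ᵐ[halfLine] dilation (t - s) (coagulation K (f s))) ∧
    IntervalIntegrable Φ volume 0 t ∧
    f t =ᵐ[halfLine] fun x => dilation t f₀ x + (∫ s in (0 : ℝ)..t, Φ s : WeightedL1 k) x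

/-- Self-similar profiles: time-independent mild solutions in `L¹_1`. -/
def IsProfile (K : ℝ → ℝ → ℝ) (G : WeightedL1 1) : Prop :=
  IsMildSolution K G (fun _ => G)

/-- Nonnegative almost everywhere on `(0, ∞)`, with total mass `∫₀^∞ x g(x) dx` equal to one. -/
def IsUnitMassDensity (g : ℝ → ℝ) : Prop :=
  (∀ᵐ x ∂halfLine, 0 ≤ g x) ∧ Integrable (fun x => x * g x) halfLine ∧
    ∫ x, x * g x ∂halfLine = 1

/-- The norm `‖g‖_{L²(0,∞)}`, for `g ∈ L²(0,∞)`. -/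
def normL2 (g : ℝ → ℝ) : ℝ := (eLpNorm g 2 halfLine).toReal

/-- The norm `‖g‖_{L¹_k} = ∫₀^∞ |g(x)| (1 + x)^k dx`, for `g ∈ L¹_k`. -/
def normL1 (k : ℝ) (g : ℝ → ℝ) : ℝ := ∫ x, |g x| * (1 + x) ^ k ∂halfLine

/-- Closed formulas in two variables `a` and `b`, built from rational numbers by means of
addition, multiplication, inversion, maximum, exponential and logarithm. They make precise what
an explicit constant depending on two quantities is. -/
inductive ExplicitFormula : Type
  | a : ExplicitFormula
  | b : ExplicitFormula
  | const (q : ℚ) : ExplicitFormula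
  | add (u v : ExplicitFormula) : ExplicitFormula
  | mul (u v : ExplicitFormula) : ExplicitFormula
  | inv (u : ExplicitFormula) : ExplicitFormula
  | max (u v : ExplicitFormula) : ExplicitFormula
  | exp (u : ExplicitFormula) : ExplicitFormula
  | log (u : ExplicitFormula) : ExplicitFormula

/-- The value of a closed formula at `a = A` and `b = B`. -/
def ExplicitFormula.eval (A B : ℝ) : ExplicitFormula → ℝ
  | .a => A
  | .b => B
  | .const q => (q : ℝ)
  | .add u v => u.eval A B + v.eval A B
  | .mul u v => u.eval A B * v.eval A B
  | .inv u => (u.eval A B)⁻¹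
  | .max u v => Max.max (u.eval A B) (v.eval A B)
  | .exp u => Real.exp (u.eval A B)
  | .log u => Real.log (u.eval A B)

end

/-! For the constant kernel the Fourier transform solves the equation explicitly. With `halfFourier`
written as a hat, coagulation becomes ĝ² - 2ĝ(0)ĝ, and the dilation S_r sends ĝ(ξ) to e^r
ĝ(e^{-r}ξ). Along the characteristics ξ = e^t w the transport term disappears, and y(t) =
e^{-t}(f̂(t,0) - f̂(t,e^t w)) satisfies y' = -e^t y², as does e^{-t} f̂(t,0). With a = e^t, m =
f̂₀(0) and φ = m - f̂₀(w), this gives (`IsMildSolution.halfFourier_eq`) f̂(t,aw) = am/(1+(a-1)m) -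
aφ/(1+(a-1)φ).

For a stationary solution of unit mass, the equation at zero frequency forces Ĝ(0) = 1. Following a
characteristic back to frequency zero, where the slope of Ĝ is -i times the mass, leaves only Ĝ(ξ) =
1/(1+iξ), the transform of e^{-x}.

For the rate, the formula is compared with 1/(1+iaw). At low frequencies the second moment gives φ =
iw + O(w²), and the difference is O(1/a). At high frequencies both terms are small separately,
provided Re φ = ∫(1 - cos(wx)) f₀ stays away from zero:
`HasMomentBounds.inv_le_integral_one_sub_cos` proves this quantitatively, since a function bounded
in L² with bounded second moment cannot concentrate near the zeros of 1 - cos(wx). The squared error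
at ξ = aw is then a^{-2} times an integrable function of w (`sq_norm_explicit_sub_profile_le`);
since dξ = a dw, its integral is O(1/a). Plancherel and a square root give e^{-t/2}. -/

open Filter Topology
open scoped FourierTransform SchwartzMap ContDiff

/-! ### Plancherel's identity for integrable functions on the line -/

theorem continuous_fourier_of_integrable {g : ℝ → ℂ} (hg : Integrable g) : Continuous (𝓕 g) :=
  VectorFourier.fourierIntegral_continuous Real.continuous_fourierChar
    (L := innerₗ ℝ) continuous_inner hg

theorem integral_schwartz_fourier_mul {g : ℝ → ℂ} (hg : Integrable g) (φ : 𝓢(ℝ, ℂ)) :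
    ∫ x, (𝓕 φ) x * g x = ∫ x, φ x * 𝓕 g x := by
  simpa using! VectorFourier.integral_bilin_fourierIntegral_eq_flip (.mul ℂ ℂ) (L := innerₗ ℝ)
    Real.continuous_fourierChar continuous_inner φ.integrable hg

theorem ae_eq_of_integral_schwartz_mul_eq {g h : ℝ → ℂ} (hg : LocallyIntegrable g)
    (hh : LocallyIntegrable h) (H : ∀ φ : 𝓢(ℝ, ℂ), ∫ x, φ x * g x = ∫ x, φ x * h x) :
    g =ᵐ[volume] h := by
  refine ae_eq_of_integral_contDiff_smul_eq hg hh fun φ hφ hc => ?_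
  have hc' : HasCompactSupport (fun x => (φ x : ℂ)) := hc.comp_left (g := ((↑) : ℝ → ℂ)) (by simp)
  exact H (hc'.toSchwartzMap (Complex.ofRealCLM.contDiff.comp hφ))

/-- Both transforms define the same tempered distribution, because the Fourier transform can be
moved onto the Schwartz test function; two locally integrable functions that agree as distributions
agree almost everywhere. -/
theorem fourier_toLp_ae_eq {g : ℝ → ℂ} (hg : Integrable g) (h2 : MemLp g 2) :
    (𝓕 (h2.toLp g) : Lp ℂ 2 (volume : Measure ℝ)) =ᵐ[volume] 𝓕 g := by
  refine ae_eq_of_integral_schwartz_mul_eq ((Lp.memLp _).locallyIntegrable (by norm_num))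
    (continuous_fourier_of_integrable hg).locallyIntegrable fun φ => ?_
  have := congrArg (fun T => T φ) (Lp.fourier_toTemperedDistribution_eq (h2.toLp g))
  simp only [TemperedDistribution.fourier_apply, Lp.toTemperedDistribution_apply,
    smul_eq_mul] at this
  rw [← this, ← integral_schwartz_fourier_mul hg φ]
  refine integral_congr_ae ?_
  filter_upwards [h2.coeFn_toLp] with x hx
  rw [hx]

theorem fourierInv_toLp_ae_eq {g : ℝ → ℂ} (hg : Integrable g) (h2 : MemLp (𝓕 g) 2) :
    (𝓕⁻ (h2.toLp (𝓕 g)) : Lp ℂ 2 (volume : Measure ℝ)) =ᵐ[volume] g := by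
  refine ae_eq_of_integral_schwartz_mul_eq ((Lp.memLp _).locallyIntegrable (by norm_num))
    hg.locallyIntegrable fun φ => ?_
  have := congrArg (fun T => T φ) (Lp.fourierInv_toTemperedDistribution_eq (h2.toLp (𝓕 g)))
  simp only [TemperedDistribution.fourierInv_apply, Lp.toTemperedDistribution_apply,
    smul_eq_mul] at this
  rw [← this]
  have h3 := integral_schwartz_fourier_mul hg (𝓕⁻ φ)
  rw [FourierTransform.fourier_fourierInv_eq] at h3
  rw [h3]
  refine integral_congr_ae ?_
  filter_upwards [h2.coeFn_toLp] with x hx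
  rw [hx]

/-- Plancherel's identity for an integrable and square integrable function. -/
theorem eLpNorm_fourier_eq {g : ℝ → ℂ} (hg : Integrable g) (h2 : MemLp g 2) :
    eLpNorm (𝓕 g) 2 = eLpNorm g 2 := by
  rw [← eLpNorm_congr_ae (fourier_toLp_ae_eq hg h2), ← eLpNorm_congr_ae h2.coeFn_toLp,
    ← Lp.enorm_def, ← Lp.enorm_def, ← ofReal_norm, ← ofReal_norm, Lp.norm_fourier_eq]

/-- Plancherel's identity for an integrable function with square integrable Fourier transform. -/
theorem eLpNorm_fourier_eq' {g : ℝ → ℂ} (hg : Integrable g) (h2 : MemLp (𝓕 g) 2) :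
    eLpNorm (𝓕 g) 2 = eLpNorm g 2 := by
  refine eLpNorm_fourier_eq hg ?_
  exact (memLp_congr_ae (fourierInv_toLp_ae_eq hg h2)).1 (Lp.memLp _)

/-! ### The Fourier transform on the half line -/

noncomputable section

/-- The Fourier transform `∫₀^∞ e^{-iξx} g(x) dx` of a function on the half line. -/
def halfFourier (g : ℝ → ℝ) (ξ : ℝ) : ℂ :=
  ∫ x, Complex.exp (-(ξ * x : ℝ) * Complex.I) * g x ∂halfLine

theorem halfFourier_two_pi_mul (g : ℝ → ℝ) (ξ : ℝ) :
    halfFourier g (2 * Real.pi * ξ) = 𝓕 (indicator (Ioi 0) fun x => (g x : ℂ)) ξ := by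
  rw [Real.fourier_real_eq_integral_exp_smul, halfFourier, halfLine,
    ← integral_indicator measurableSet_Ioi]
  congr 1 with x
  by_cases hx : x ∈ Ioi (0 : ℝ)
  · simp only [indicator_of_mem hx, smul_eq_mul]
    congr 3
    push_cast
    ring
  · simp [indicator_of_notMem hx]

theorem halfFourier_congr {g h : ℝ → ℝ} (H : g =ᵐ[halfLine] h) : halfFourier g = halfFourier h := by
  ext ξ
  refine integral_congr_ae ?_
  filter_upwards [H] with x hx
  rw [hx]

theorem norm_halfFourier_kernel (ξ x : ℝ) (z : ℂ) :
    ‖Complex.exp (-(ξ * x : ℝ) * Complex.I) * z‖ = ‖z‖ := by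
  rw [norm_mul, ← Complex.ofReal_neg, Complex.norm_exp_ofReal_mul_I, one_mul]

theorem integrable_halfFourier_kernel {g : ℝ → ℂ} (hg : Integrable g halfLine) (ξ : ℝ) :
    Integrable (fun x => Complex.exp (-(ξ * x : ℝ) * Complex.I) * g x) halfLine := by
  refine hg.mono ?_ (ae_of_all _ fun x => (norm_halfFourier_kernel ξ x _).le)
  exact AEStronglyMeasurable.mul (by fun_prop) hg.1

theorem integrable_indicator_ofReal {g : ℝ → ℝ} (hg : Integrable g halfLine) :
    Integrable (indicator (Ioi 0) fun x => (g x : ℂ)) :=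
  (integrable_indicator_iff measurableSet_Ioi).2 hg.ofReal

theorem lintegral_comp_mul_left_real (f : ℝ → ENNReal) {a : ℝ} (ha : 0 < a) :
    ENNReal.ofReal a * ∫⁻ x, f (a * x) = ∫⁻ x, f x := by
  have h1 : ∫⁻ x, f x ∂(Measure.map (a * ·) volume) = ∫⁻ x, f (a * x) :=
    lintegral_map_equiv f (Homeomorph.mulLeft₀ a ha.ne').toMeasurableEquiv
  rw [← h1, Real.map_volume_mul_left ha.ne', lintegral_smul_measure, smul_eq_mul, ← mul_assoc,
    ← ENNReal.ofReal_mul ha.le, abs_of_pos (inv_pos.2 ha), mul_inv_cancel₀ ha.ne',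
    ENNReal.ofReal_one, one_mul]

theorem eLpNorm_two_sq {α E : Type*} [MeasurableSpace α] [NormedAddCommGroup E] (f : α → E)
    (μ : Measure α) : eLpNorm f 2 μ ^ 2 = ∫⁻ x, ‖f x‖ₑ ^ 2 ∂μ := by
  rw [eLpNorm_eq_lintegral_rpow_enorm_toReal (by norm_num) (by norm_num), ← ENNReal.rpow_natCast,
    ← ENNReal.rpow_mul]
  norm_num

theorem lintegral_halfFourier_sq (g : ℝ → ℝ) :
    ∫⁻ ξ, ‖halfFourier g ξ‖ₑ ^ 2 = ENNReal.ofReal (2 * Real.pi) *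
      eLpNorm (𝓕 (indicator (Ioi 0) fun x => (g x : ℂ))) 2 ^ 2 := by
  rw [← lintegral_comp_mul_left_real _ Real.two_pi_pos, eLpNorm_two_sq]
  simp_rw [halfFourier_two_pi_mul]

theorem eLpNorm_indicator_ofReal (g : ℝ → ℝ) :
    eLpNorm (indicator (Ioi 0) fun x => (g x : ℂ)) 2 = eLpNorm g 2 halfLine := by
  rw [eLpNorm_indicator_eq_eLpNorm_restrict measurableSet_Ioi]
  exact eLpNorm_congr_norm_ae (ae_of_all _ fun x => by simp)

theorem lintegral_halfFourier_sq_of_memLp {g : ℝ → ℝ} (hg : Integrable g halfLine)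
    (h2 : MemLp g 2 halfLine) :
    ∫⁻ ξ, ‖halfFourier g ξ‖ₑ ^ 2 = ENNReal.ofReal (2 * Real.pi) * eLpNorm g 2 halfLine ^ 2 := by
  rw [lintegral_halfFourier_sq, eLpNorm_fourier_eq (integrable_indicator_ofReal hg),
    eLpNorm_indicator_ofReal]
  exact (memLp_indicator_iff_restrict measurableSet_Ioi).2 h2.ofReal

/-- Square integrability of `g` is a conclusion here, not a hypothesis. This matters for the
solution at positive times, which is only known to be integrable. -/
theorem lintegral_halfFourier_sq_of_lt_top {g : ℝ → ℝ} (hg : Integrable g halfLine)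
    (h2 : ∫⁻ ξ, ‖halfFourier g ξ‖ₑ ^ 2 < ⊤) :
    ∫⁻ ξ, ‖halfFourier g ξ‖ₑ ^ 2 = ENNReal.ofReal (2 * Real.pi) * eLpNorm g 2 halfLine ^ 2 := by
  have hi := integrable_indicator_ofReal hg
  rw [lintegral_halfFourier_sq] at h2
  rw [lintegral_halfFourier_sq, eLpNorm_fourier_eq' hi, eLpNorm_indicator_ofReal]
  refine ⟨(continuous_fourier_of_integrable hi).aestronglyMeasurable, ?_⟩
  by_contra h
  rw [not_lt, top_le_iff] at h
  rw [h] at h2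
  simp [ENNReal.mul_top, Real.pi_pos] at h2

/-- The Fourier transform is injective on integrable functions on the half line. -/
theorem ae_eq_of_halfFourier_eq {g h : ℝ → ℝ} (hg : Integrable g halfLine)
    (hh : Integrable h halfLine) (H : ∀ ξ, halfFourier g ξ = halfFourier h ξ) :
    g =ᵐ[halfLine] h := by
  have h0 : ∀ ξ, halfFourier (g - h) ξ = 0 := fun ξ => by
    have : halfFourier (g - h) ξ = halfFourier g ξ - halfFourier h ξ := by
      rw [halfFourier, halfFourier, halfFourier, ← integral_sub
        (integrable_halfFourier_kernel (g := fun x => (g x : ℂ)) hg.ofReal ξ)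
        (integrable_halfFourier_kernel (g := fun x => (h x : ℂ)) hh.ofReal ξ)]
      congr 1 with x
      simp [mul_sub]
    rw [this, H, sub_self]
  have h1 := lintegral_halfFourier_sq_of_lt_top (hg.sub hh) (by simp [h0])
  have h2 : eLpNorm (g - h) 2 halfLine = 0 := by simpa [h0, Real.pi_pos.not_ge] using h1.symm
  rw [eLpNorm_eq_zero_iff (hg.sub hh).1 (by norm_num)] at h2
  filter_upwards [h2] with x hx
  simpa [sub_eq_zero] using hx
end

/-! ### Weighted spaces, and the action of the Fourier transform on dilations and coagulation -/

noncomputable section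

theorem ae_halfLine_pos : ∀ᵐ x ∂halfLine, 0 < x := ae_restrict_mem measurableSet_Ioi

theorem measurable_weight (k : ℝ) : Measurable fun x : ℝ => ENNReal.ofReal ((1 + x) ^ k) := by
  fun_prop

theorem halfLine_le_weightMeasure {k : ℝ} (hk : 0 ≤ k) : halfLine ≤ weightMeasure k := by
  have h := withDensity_mono (μ := halfLine) (f := 1)
    (g := fun x => ENNReal.ofReal ((1 + x) ^ k)) (by
      filter_upwards [ae_halfLine_pos] with x hx
      simpa using Real.one_le_rpow (by linarith) hk)
  rwa [withDensity_one] at h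

theorem ae_weightMeasure_iff (k : ℝ) {p : ℝ → Prop} :
    (∀ᵐ x ∂weightMeasure k, p x) ↔ ∀ᵐ x ∂halfLine, p x := by
  rw [weightMeasure, ae_withDensity_iff (measurable_weight k)]
  refine Filter.eventually_congr ?_
  filter_upwards [ae_halfLine_pos] with x hx
  simp [Real.rpow_pos_of_pos (by linarith : 0 < 1 + x) k]

theorem WeightedL1.integrable {k : ℝ} (hk : 0 ≤ k) (g : WeightedL1 k) : Integrable g halfLine :=
  (memLp_one_iff_integrable.1 (Lp.memLp g)).mono_measure (halfLine_le_weightMeasure hk)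

theorem norm_halfFourier_le (g : ℝ → ℝ) (ξ : ℝ) : ‖halfFourier g ξ‖ ≤ ∫ x, ‖g x‖ ∂halfLine := by
  refine (norm_integral_le_integral_norm _).trans_eq ?_
  simp_rw [norm_halfFourier_kernel, Complex.norm_real]

theorem halfFourier_add {g h : ℝ → ℝ} (hg : Integrable g halfLine) (hh : Integrable h halfLine)
    (ξ : ℝ) : halfFourier (fun x => g x + h x) ξ = halfFourier g ξ + halfFourier h ξ := by
  rw [halfFourier, halfFourier, halfFourier, ← integral_add
        (integrable_halfFourier_kernel (g := fun x => (g x : ℂ)) hg.ofReal ξ)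
        (integrable_halfFourier_kernel (g := fun x => (h x : ℂ)) hh.ofReal ξ)]
  congr 1 with x
  simp [mul_add]

theorem halfFourier_const_mul (c : ℝ) (g : ℝ → ℝ) (ξ : ℝ) :
    halfFourier (fun x => c * g x) ξ = c * halfFourier g ξ := by
  rw [halfFourier, halfFourier, ← integral_const_mul]
  congr 1 with x
  push_cast
  ring

theorem halfFourier_sub {g h : ℝ → ℝ} (hg : Integrable g halfLine) (hh : Integrable h halfLine)
    (ξ : ℝ) : halfFourier (fun x => g x - h x) ξ = halfFourier g ξ - halfFourier h ξ := by
  have := halfFourier_add hg (hh.const_mul (-1)) ξ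
  rw [halfFourier_const_mul] at this
  simpa [sub_eq_add_neg] using this

theorem halfFourier_zero (g : ℝ → ℝ) : halfFourier g 0 = (∫ x, g x ∂halfLine : ℝ) := by
  simp [halfFourier, integral_complex_ofReal]

/-- The Fourier transform at a given frequency, as a continuous linear form on `L¹_k`. -/
def halfFourierCLM {k : ℝ} (hk : 0 ≤ k) (ξ : ℝ) : WeightedL1 k →L[ℝ] ℂ :=
  LinearMap.mkContinuous
    { toFun := fun g => halfFourier g ξ
      map_add' := fun g h => by
        rw [← halfFourier_add (WeightedL1.integrable hk g) (WeightedL1.integrable hk h)]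
        refine congrFun (halfFourier_congr ?_) ξ
        exact (ae_weightMeasure_iff k).1 (Lp.coeFn_add g h)
      map_smul' := fun c g => by
        rw [RingHom.id_apply, Complex.real_smul, ← halfFourier_const_mul]
        refine congrFun (halfFourier_congr ?_) ξ
        exact (ae_weightMeasure_iff k).1 (Lp.coeFn_smul c g) }
    1 (fun g => by
      refine (norm_halfFourier_le g ξ).trans ?_
      rw [one_mul, L1.norm_eq_integral_norm]
      exact integral_mono_measure (halfLine_le_weightMeasure hk)
        (ae_of_all _ fun x => norm_nonneg _) (memLp_one_iff_integrable.1 (Lp.memLp g)).norm)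

theorem halfFourierCLM_apply {k : ℝ} (hk : 0 ≤ k) (ξ : ℝ) (g : WeightedL1 k) :
    halfFourierCLM hk ξ g = halfFourier g ξ := rfl

theorem integrable_dilation {g : ℝ → ℝ} (hg : Integrable g halfLine) (r : ℝ) :
    Integrable (dilation r g) halfLine := by
  have := (integrableOn_Ioi_comp_mul_left_iff g 0 (Real.exp_pos r)).2 (by rwa [mul_zero])
  exact this.const_mul _

theorem halfFourier_dilation (g : ℝ → ℝ) (r ξ : ℝ) :
    halfFourier (dilation r g) ξ = Real.exp r * halfFourier g (Real.exp (-r) * ξ) := by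
  have h := integral_comp_mul_left_Ioi
    (fun x => Complex.exp (-(Real.exp (-r) * ξ * x : ℝ) * Complex.I) * g x) 0 (Real.exp_pos r)
  rw [mul_zero] at h
  have h2 : ((Real.exp r : ℝ) : ℂ) = (Real.exp (2 * r) : ℝ) * ((Real.exp r)⁻¹ : ℝ) := by
    rw [← Complex.ofReal_mul, ← Real.exp_neg, ← Real.exp_add]
    ring_nf
  rw [halfFourier, halfFourier, halfLine, h2, mul_assoc, ← Complex.real_smul (x := (Real.exp r)⁻¹),
    ← h, ← integral_const_mul]
  congr 1 with x
  have h3 : Real.exp (-r) * ξ * (Real.exp r * x) = ξ * x := by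
    have : Real.exp (-r) * Real.exp r = 1 := by rw [← Real.exp_add]; simp
    linear_combination ξ * x * this
  rw [h3, dilation]
  push_cast
  ring

theorem coagulation_two (g : ℝ → ℝ) (x : ℝ) :
    coagulation (fun _ _ => 2) g x =
      (∫ y in (0 : ℝ)..x, g y * g (x - y)) - 2 * (∫ y, g y ∂halfLine) * g x := by
  rw [coagulation, halfLine, integral_const_mul, ← intervalIntegral.integral_const_mul]
  congr 1
  · congr 1 with y
    ring
  · ring

theorem integrable_selfConvolution {g : ℝ → ℝ} (hg : Integrable g halfLine) :
    Integrable (fun x => ∫ y in (0 : ℝ)..x, g y * g (x - y)) halfLine := by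
  have := integrable_posConvolution (μ := volume) (ν := volume) (f := g) (g := g) hg hg
    (ContinuousLinearMap.mul ℝ ℝ)
  rw [posConvolution, integrable_indicator_iff measurableSet_Ioi] at this
  exact this

theorem integrable_coagulation_two {g : ℝ → ℝ} (hg : Integrable g halfLine) :
    Integrable (coagulation (fun _ _ => 2) g) halfLine := by
  have := (integrable_selfConvolution hg).sub (hg.const_mul (2 * (∫ y, g y ∂halfLine)))
  exact this.congr (ae_of_all _ fun x => (coagulation_two g x).symm)

theorem halfFourier_selfConvolution {g : ℝ → ℝ} (hg : Integrable g halfLine) (ξ : ℝ) :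
    halfFourier (fun x => ∫ y in (0 : ℝ)..x, g y * g (x - y)) ξ = halfFourier g ξ ^ 2 := by
  have hi := integrable_halfFourier_kernel (g := fun x => (g x : ℂ)) hg.ofReal ξ
  have := integral_posConvolution (μ := volume) (ν := volume) hi hi (ContinuousLinearMap.mul ℝ ℂ)
  rw [sq]
  refine Eq.trans ?_ this
  rw [halfFourier, halfLine]
  congr 1 with x
  rw [← intervalIntegral.integral_ofReal, ← intervalIntegral.integral_const_mul]
  congr 1 with y
  -- The character is multiplicative, so the transform of the convolution is the integral of a
  -- convolution of the two modulated functions.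
  rw [ContinuousLinearMap.mul_apply']
  have : Complex.exp (-(ξ * x : ℝ) * Complex.I) =
      Complex.exp (-(ξ * y : ℝ) * Complex.I) * Complex.exp (-(ξ * (x - y) : ℝ) * Complex.I) := by
    rw [← Complex.exp_add]
    push_cast
    ring_nf
  rw [this]
  push_cast
  ring

theorem halfFourier_coagulation_two {g : ℝ → ℝ} (hg : Integrable g halfLine) (ξ : ℝ) :
    halfFourier (coagulation (fun _ _ => 2) g) ξ =
      halfFourier g ξ ^ 2 - 2 * halfFourier g 0 * halfFourier g ξ := by
  have : coagulation (fun _ _ => 2) g = fun x =>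
      (∫ y in (0 : ℝ)..x, g y * g (x - y)) - (2 * (∫ y, g y ∂halfLine)) * g x :=
    funext (coagulation_two g)
  rw [this, halfFourier_sub (integrable_selfConvolution hg) (hg.const_mul _),
    halfFourier_selfConvolution hg, halfFourier_const_mul, halfFourier_zero]
  push_cast
  ring
end

/-! ### Riccati equations along characteristics -/

noncomputable section

/-- The integral equation `y' = -e^s y²` has the explicit solution `y₀ / (1 + (e^t - 1) y₀)`. -/
theorem riccati_solution {y : ℝ → ℂ} {y₀ : ℂ}
    (hi : ∀ t, 0 ≤ t → IntervalIntegrable (fun s => Real.exp s * y s ^ 2) volume 0 t)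
    (hy : ∀ t, 0 ≤ t → y t = y₀ - ∫ s in (0 : ℝ)..t, Real.exp s * y s ^ 2) {t : ℝ} (ht : 0 ≤ t) :
    y t * (1 + (Real.exp t - 1) * y₀) = y₀ := by
  -- Continuity is not assumed: it follows from the integral equation, whose right side is a
  -- primitive.
  have hcont : ContinuousOn y (Icc 0 t) := by
    have := intervalIntegral.continuousOn_primitive_interval (a := (0 : ℝ)) (b := t)
      (f := fun s => (Real.exp s * y s ^ 2 : ℂ)) (μ := volume)
      ((intervalIntegrable_iff' enorm_ne_top).1 (hi t ht))
    rw [uIcc_of_le ht] at this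
    exact (continuousOn_const.sub this).congr fun s hs => hy s hs.1
  -- Extending `y` by constants outside `[0, t]` makes the primitive differentiable at every point,
  -- endpoints included.
  obtain ⟨Y, hYc, hY⟩ : ∃ Y : ℝ → ℂ, Continuous Y ∧ ∀ s ∈ Icc 0 t, Y s = y s := by
    refine ⟨IccExtend ht ((Icc 0 t).domRestrict y), hcont.domRestrict.Icc_extend', fun s hs => ?_⟩
    rw [IccExtend_of_mem _ _ hs]
    rfl
  have hYeq : ∀ s ∈ Icc 0 t, y₀ - ∫ r in (0 : ℝ)..s, Real.exp r * Y r ^ 2 = Y s := by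
    intro s hs
    rw [hY s hs, hy s hs.1]
    congr 1
    refine intervalIntegral.integral_congr fun r hr => ?_
    rw [uIcc_of_le hs.1] at hr
    simp only [hY r ⟨hr.1, hr.2.trans hs.2⟩]
  have hder : ∀ s, HasDerivAt (fun s => y₀ - ∫ r in (0 : ℝ)..s, Real.exp r * Y r ^ 2)
      (-(Real.exp s * Y s ^ 2)) s := fun s =>
    ((Continuous.integral_hasStrictDerivAt (by fun_prop) 0 s).hasDerivAt).const_sub _
  set Z : ℝ → ℂ := fun s => y₀ - ∫ r in (0 : ℝ)..s, Real.exp r * Y r ^ 2 with hZ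
  have hexp : ∀ s : ℝ, HasDerivAt (fun s : ℝ => (1 + (Real.exp s - 1) * y₀ : ℂ))
      (Real.exp s * y₀) s := fun s =>
    (((Real.hasDerivAt_exp s).ofReal_comp.sub_const 1).mul_const y₀).const_add 1
  have hP : ∀ s, HasDerivAt (fun s => Z s * (1 + (Real.exp s - 1) * y₀) - y₀)
      (-(Real.exp s * Y s ^ 2) * (1 + (Real.exp s - 1) * y₀) + Z s * (Real.exp s * y₀)) s :=
    fun s => ((hder s).mul (hexp s)).sub_const _
  obtain ⟨K, hK⟩ := isCompact_Icc.exists_bound_of_continuousOn (s := Icc 0 t)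
    (f := fun s => (Real.exp s * Y s : ℂ)) (by fun_prop)
  -- The defect P = Y(1 + (e^s - 1)y₀) - y₀ satisfies the linear equation P' = -e^s Y P with P(0) =
  -- 0, so it vanishes by Gronwall. No division by a possibly zero denominator is needed.
  have key := eq_zero_of_abs_deriv_le_mul_abs_self_of_eq_zero_right (K := K) (a := 0) (b := t)
    (f := fun s => Z s * (1 + (Real.exp s - 1) * y₀) - y₀)
    (fun s _ => (hP s).continuousAt.continuousWithinAt)
    (fun s _ => (hP s).hasDerivWithinAt) (by simp [hZ])
    (fun s hs => by
      have hs' := Ico_subset_Icc_self hs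
      rw [show Z s = Y s from hYeq s hs']
      have : -(Real.exp s * Y s ^ 2) * (1 + (Real.exp s - 1) * y₀) + Y s * (Real.exp s * y₀) =
          -(Real.exp s * Y s : ℂ) * (Y s * (1 + (Real.exp s - 1) * y₀) - y₀) := by ring
      rw [this, norm_mul, norm_neg]
      exact mul_le_mul_of_nonneg_right (hK s hs') (norm_nonneg _)) t ⟨ht, le_rfl⟩
  have hZt : Z t = y t := (hYeq t ⟨ht, le_rfl⟩).trans (hY t ⟨ht, le_rfl⟩)
  rw [← hZt]
  exact sub_eq_zero.1 key

variable {k : ℝ} {f₀ : WeightedL1 k} {f : ℝ → WeightedL1 k}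

/-- At frequency e^t w the dilation S_{t-s} evaluates the transform at e^s w, with factor e^{t-s}.
After division by e^t the integrand no longer depends on t, so Duhamel's formula becomes an ordinary
integral equation in time. -/
theorem IsMildSolution.halfFourier_duhamel (hk : 0 ≤ k)
    (h : IsMildSolution (fun _ _ => 2) f₀ f) {t : ℝ} (ht : 0 ≤ t) (w : ℝ) :
    IntervalIntegrable (fun s => (Real.exp (-s) : ℂ) * (halfFourier (f s) (Real.exp s * w) ^ 2 -
      2 * halfFourier (f s) 0 * halfFourier (f s) (Real.exp s * w))) volume 0 t ∧
    Real.exp (-t) * halfFourier (f t) (Real.exp t * w) = halfFourier f₀ w +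
      ∫ s in (0 : ℝ)..t, (Real.exp (-s) : ℂ) * (halfFourier (f s) (Real.exp s * w) ^ 2 -
        2 * halfFourier (f s) 0 * halfFourier (f s) (Real.exp s * w)) := by
  obtain ⟨Φ, hΦ, hi, hf⟩ := h.duhamel t ht
  set L := halfFourierCLM hk (Real.exp t * w)
  have hL : ∀ s ∈ Icc 0 t, (Real.exp (-t) : ℂ) * L (Φ s) =
      (Real.exp (-s) : ℂ) * (halfFourier (f s) (Real.exp s * w) ^ 2 -
      2 * halfFourier (f s) 0 * halfFourier (f s) (Real.exp s * w)) := by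
    intro s hs
    rw [halfFourierCLM_apply, halfFourier_congr (hΦ s hs), halfFourier_dilation,
      halfFourier_coagulation_two (WeightedL1.integrable hk _), ← mul_assoc,
      ← Complex.ofReal_mul, ← Real.exp_add, ← mul_assoc (Real.exp _) (Real.exp _) w,
      ← Real.exp_add]
    ring_nf
  have hLi : IntervalIntegrable (fun s => (Real.exp (-t) : ℂ) * L (Φ s)) volume 0 t := by
    refine IntervalIntegrable.const_mul ?_ _
    rw [intervalIntegrable_iff] at hi ⊢
    exact L.integrable_comp hi
  have huI : ∀ s ∈ uIoc 0 t, s ∈ Icc 0 t := fun s hs => by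
    rw [uIoc_of_le ht] at hs
    exact Ioc_subset_Icc_self hs
  refine ⟨hLi.congr fun s hs => hL s (huI s hs), ?_⟩
  rw [← intervalIntegral.integral_congr (g := _) (f := fun s => (Real.exp (-t) : ℂ) * L (Φ s))
    (fun s hs => hL s (by rwa [uIcc_of_le ht] at hs)), intervalIntegral.integral_const_mul,
    ContinuousLinearMap.intervalIntegral_comp_comm L hi, halfFourierCLM_apply,
    halfFourier_congr hf, halfFourier_add (integrable_dilation (WeightedL1.integrable hk _) t)
    (WeightedL1.integrable hk _), halfFourier_dilation, mul_add, ← mul_assoc,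
    ← mul_assoc (Real.exp _) (Real.exp _) w, ← Complex.ofReal_mul, ← Real.exp_add]
  simp

/-- The Fourier transform, scaled and subtracted from the number of particles, solves a Riccati
equation along characteristics. -/
theorem IsMildSolution.halfFourier_riccati (hk : 0 ≤ k)
    (h : IsMildSolution (fun _ _ => 2) f₀ f) {t : ℝ} (ht : 0 ≤ t) (w : ℝ) :
    Real.exp (-t) * (halfFourier (f t) 0 - halfFourier (f t) (Real.exp t * w)) *
      (1 + (Real.exp t - 1) * (halfFourier f₀ 0 - halfFourier f₀ w)) =
    halfFourier f₀ 0 - halfFourier f₀ w := by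
  have e1 : ∀ s : ℝ, (Real.exp (-s) : ℂ) = Real.exp s * (Real.exp (-s) * Real.exp (-s)) :=
    fun s => by
      rw [← Complex.ofReal_mul, ← Complex.ofReal_mul, ← Real.exp_add, ← Real.exp_add]
      ring_nf
  have e2 : ∀ s : ℝ, (Real.exp s : ℂ) *
      (Real.exp (-s) * (halfFourier (f s) 0 - halfFourier (f s) (Real.exp s * w))) ^ 2 =
      -(Real.exp (-s) * (halfFourier (f s) (Real.exp s * 0) ^ 2 -
      2 * halfFourier (f s) 0 * halfFourier (f s) (Real.exp s * 0)) -
      Real.exp (-s) * (halfFourier (f s) (Real.exp s * w) ^ 2 -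
      2 * halfFourier (f s) 0 * halfFourier (f s) (Real.exp s * w))) := fun s => by
    rw [mul_zero]
    linear_combination (- (halfFourier (f s) 0 - halfFourier (f s) (Real.exp s * w)) ^ 2) * e1 s
  refine riccati_solution (y := fun s => (Real.exp (-s) : ℂ) *
    (halfFourier (f s) 0 - halfFourier (f s) (Real.exp s * w))) (fun s hs => ?_)
    (fun s hs => ?_) ht
  · simp_rw [e2]
    exact ((h.halfFourier_duhamel hk hs 0).1.sub (h.halfFourier_duhamel hk hs w).1).neg
  · simp_rw [e2]
    obtain ⟨i0, h0⟩ := h.halfFourier_duhamel hk hs 0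
    obtain ⟨iw, hw⟩ := h.halfFourier_duhamel hk hs w
    rw [intervalIntegral.integral_neg, intervalIntegral.integral_sub i0 iw, mul_sub, hw]
    nth_rewrite 1 [← mul_zero (Real.exp s)]
    rw [h0]
    ring

/-- The number of particles solves a Riccati equation. -/
theorem IsMildSolution.halfFourier_zero_riccati (hk : 0 ≤ k)
    (h : IsMildSolution (fun _ _ => 2) f₀ f) {t : ℝ} (ht : 0 ≤ t) :
    Real.exp (-t) * halfFourier (f t) 0 * (1 + (Real.exp t - 1) * halfFourier f₀ 0) =
      halfFourier f₀ 0 := by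
  have e1 : ∀ s : ℝ, (Real.exp (-s) : ℂ) = Real.exp s * (Real.exp (-s) * Real.exp (-s)) :=
    fun s => by
      rw [← Complex.ofReal_mul, ← Complex.ofReal_mul, ← Real.exp_add, ← Real.exp_add]
      ring_nf
  have e2 : ∀ s : ℝ, (Real.exp s : ℂ) * (Real.exp (-s) * halfFourier (f s) 0) ^ 2 =
      -(Real.exp (-s) * (halfFourier (f s) (Real.exp s * 0) ^ 2 -
      2 * halfFourier (f s) 0 * halfFourier (f s) (Real.exp s * 0))) := fun s => by
    rw [mul_zero]
    linear_combination (- (halfFourier (f s) 0) ^ 2) * e1 s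
  refine riccati_solution (y := fun s => (Real.exp (-s) : ℂ) * halfFourier (f s) 0)
    (fun s hs => ?_) (fun s hs => ?_) ht
  · simp_rw [e2]
    exact (h.halfFourier_duhamel hk hs 0).1.neg
  · simp_rw [e2]
    obtain ⟨i0, h0⟩ := h.halfFourier_duhamel hk hs 0
    rw [intervalIntegral.integral_neg, sub_neg_eq_add, ← h0, mul_zero]
end

/-! ### The function e^{-x} is a stationary solution -/

noncomputable section

/-- Injectivity of the Fourier transform replaces an argument on null sets, here and for the
coagulation operator. -/
theorem dilation_congr {g h : ℝ → ℝ} (hg : Integrable g halfLine) (H : g =ᵐ[halfLine] h) (r : ℝ) :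
    dilation r g =ᵐ[halfLine] dilation r h :=
  ae_eq_of_halfFourier_eq (integrable_dilation hg r) (integrable_dilation (hg.congr H) r) fun ξ => by
    rw [halfFourier_dilation, halfFourier_dilation, halfFourier_congr H]

theorem coagulation_two_congr {g h : ℝ → ℝ} (hg : Integrable g halfLine) (H : g =ᵐ[halfLine] h) :
    coagulation (fun _ _ => 2) g =ᵐ[halfLine] coagulation (fun _ _ => 2) h :=
  have hh := hg.congr H
  ae_eq_of_halfFourier_eq (integrable_coagulation_two hg) (integrable_coagulation_two hh) fun ξ => by
    rw [halfFourier_coagulation_two hg, halfFourier_coagulation_two hh, halfFourier_congr H]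

theorem integrable_pow_mul_exp_neg (n : ℕ) :
    Integrable (fun x : ℝ => x ^ n * Real.exp (-x)) halfLine := by
  have := Real.GammaIntegral_convergent (s := n + 1) (by positivity)
  refine Integrable.congr this (ae_of_all _ fun x => ?_)
  simp [mul_comm]

theorem integrable_exp_neg : Integrable (fun x : ℝ => Real.exp (-x)) halfLine := by
  simpa using integrable_pow_mul_exp_neg 0

theorem integrable_weightMeasure_one_iff {g : ℝ → ℝ} :
    Integrable g (weightMeasure 1) ↔ Integrable (fun x => (1 + x) * g x) halfLine := by
  rw [weightMeasure, integrable_withDensity_iff_integrable_smul' (measurable_weight 1)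
    (ae_of_all _ fun x => ENNReal.ofReal_lt_top)]
  refine integrable_congr ?_
  filter_upwards [ae_halfLine_pos] with x hx
  rw [Real.rpow_one, ENNReal.toReal_ofReal (by linarith), smul_eq_mul]

theorem integral_exp_neg_halfLine : ∫ x, Real.exp (-x) ∂halfLine = 1 :=
  integral_exp_neg_Ioi_zero

theorem one_add_mul_I_ne_zero (ξ : ℝ) : (1 + ξ * Complex.I : ℂ) ≠ 0 := fun h => by
  simpa using congrArg Complex.re h

theorem halfFourier_exp_neg (ξ : ℝ) :
    halfFourier (fun x => Real.exp (-x)) ξ = (1 + ξ * Complex.I)⁻¹ := by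
  have h := integral_exp_mul_complex_Ioi (a := -(1 + ξ * Complex.I)) (by simp) 0
  rw [halfFourier, halfLine]
  calc _ = ∫ x : ℝ in Ioi 0, Complex.exp (-(1 + ξ * Complex.I) * x) := by
        congr 1 with x
        rw [Complex.ofReal_exp, ← Complex.exp_add]
        push_cast
        ring_nf
    _ = _ := by
        rw [h, Complex.ofReal_zero, mul_zero, Complex.exp_zero, neg_div_neg_eq, one_div]

theorem coagulation_exp_neg (x : ℝ) :
    coagulation (fun _ _ => 2) (fun y => Real.exp (-y)) x = (x - 2) * Real.exp (-x) := by
  rw [coagulation_two, integral_exp_neg_halfLine]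
  have : ∀ y : ℝ, Real.exp (-y) * Real.exp (-(x - y)) = Real.exp (-x) := fun y => by
    rw [← Real.exp_add]
    ring_nf
  simp only [this, intervalIntegral.integral_const, smul_eq_mul]
  ring

/-- The dilations of the function `(x - 2) e^{-x}`. -/
def coagProfile (r x : ℝ) : ℝ := dilation r (fun x => (x - 2) * Real.exp (-x)) x

theorem abs_coagProfile_le {r T x : ℝ} (hr : r ∈ Icc 0 T) (hx : 0 < x) :
    |coagProfile r x| ≤ Real.exp (2 * T) * ((Real.exp T * x + 2) * Real.exp (-x)) := by
  have h1 : (1 : ℝ) ≤ Real.exp r := Real.one_le_exp hr.1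
  have h2 : Real.exp r ≤ Real.exp T := Real.exp_le_exp.2 hr.2
  have h3 : x ≤ Real.exp r * x := by nlinarith
  have h4 : Real.exp r * x ≤ Real.exp T * x := by nlinarith
  rw [coagProfile, dilation, abs_mul, abs_mul, Real.abs_exp, Real.abs_exp]
  gcongr
  · exact hr.2
  · rw [abs_le]
    constructor <;> linarith

theorem integrable_coagProfile_bound (T : ℝ) : Integrable
    (fun x => Real.exp (2 * T) * ((Real.exp T * x + 2) * Real.exp (-x))) (weightMeasure 1) := by
  rw [integrable_weightMeasure_one_iff]
  have h := (((integrable_pow_mul_exp_neg 2).const_mul (Real.exp T)).add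
    (((integrable_pow_mul_exp_neg 1).const_mul (Real.exp T + 2)).add
    ((integrable_pow_mul_exp_neg 0).const_mul 2))).const_mul (Real.exp (2 * T))
  refine h.congr (ae_of_all _ fun x => ?_)
  simp only [Pi.add_apply]
  ring

theorem integrable_coagProfile {r : ℝ} (hr : 0 ≤ r) :
    Integrable (coagProfile r) (weightMeasure 1) := by
  refine (integrable_coagProfile_bound r).mono' ?_ ?_
  · have : Continuous (coagProfile r) := by unfold coagProfile dilation; fun_prop
    exact this.aestronglyMeasurable
  · rw [ae_weightMeasure_iff]
    filter_upwards [ae_halfLine_pos] with x hx using abs_coagProfile_le ⟨hr, le_rfl⟩ hx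

/-- The curve of dilations of `(x - 2) e^{-x}` in `L¹_1`. -/
def coagProfileCurve (r : ℝ) : WeightedL1 1 :=
  -- The parameter is truncated to `max 0 r` to have a curve defined for all `r`; only `r ≥ 0` is
  -- used.
  (integrable_coagProfile (le_max_left 0 r)).toL1 _

theorem coagProfileCurve_ae_eq {r : ℝ} (hr : 0 ≤ r) :
    coagProfileCurve r =ᵐ[halfLine] coagProfile r := by
  have := (ae_weightMeasure_iff 1).1 (integrable_coagProfile (le_max_left 0 r)).coeFn_toL1
  simp only [max_eq_right hr] at this
  rw [coagProfileCurve]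
  simp only [max_eq_right hr]
  exact this

theorem continuousOn_coagProfileCurve (T : ℝ) : ContinuousOn coagProfileCurve (Icc 0 T) := by
  intro r₀ hr₀
  rw [ContinuousWithinAt, tendsto_iff_norm_sub_tendsto_zero]
  have h : ∀ r ∈ Icc 0 T, ‖coagProfileCurve r - coagProfileCurve r₀‖ =
      ∫ x, ‖coagProfile r x - coagProfile r₀ x‖ ∂weightMeasure 1 := fun r hr => by
    rw [coagProfileCurve, coagProfileCurve, ← Integrable.toL1_sub, L1.norm_of_fun_eq_integral_norm,
      max_eq_right hr.1, max_eq_right hr₀.1]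
    rfl
  have hmem : ∀ᶠ r in 𝓝[Icc 0 T] r₀, r ∈ Icc 0 T := self_mem_nhdsWithin
  rw [tendsto_congr' (hmem.mono h)]
  have hcont : ∀ r, Continuous (coagProfile r) := fun r => by
    unfold coagProfile dilation
    fun_prop
  have hcont' : ∀ x, Continuous fun r => coagProfile r x := fun x => by
    unfold coagProfile dilation
    fun_prop
  have key := tendsto_integral_filter_of_dominated_convergence (μ := weightMeasure 1)
    (l := 𝓝[Icc 0 T] r₀) (F := fun r x => ‖coagProfile r x - coagProfile r₀ x‖) (f := fun _ => 0)
    (fun x => 2 * (Real.exp (2 * T) * ((Real.exp T * x + 2) * Real.exp (-x))))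
    (Eventually.of_forall fun r => ((hcont r).sub (hcont r₀)).norm.aestronglyMeasurable)
    (hmem.mono fun r hr => by
      rw [ae_weightMeasure_iff]
      filter_upwards [ae_halfLine_pos] with x hx
      rw [norm_norm, two_mul]
      exact (norm_sub_le _ _).trans
        (add_le_add (abs_coagProfile_le hr hx) (abs_coagProfile_le hr₀ hx)))
    ((integrable_coagProfile_bound T).const_mul 2)
    (ae_of_all _ fun x => by
      have := (((hcont' x).sub continuous_const).norm.tendsto' r₀ 0
        (by simp) : Tendsto (fun r => ‖coagProfile r x - coagProfile r₀ x‖) _ _)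
      exact this.mono_left nhdsWithin_le_nhds)
  simpa using key

theorem integrable_exp_neg_weightMeasure_one :
    Integrable (fun x : ℝ => Real.exp (-x)) (weightMeasure 1) := by
  rw [integrable_weightMeasure_one_iff]
  refine ((integrable_pow_mul_exp_neg 0).add (integrable_pow_mul_exp_neg 1)).congr
    (ae_of_all _ fun x => ?_)
  simp only [Pi.add_apply]
  ring

/-- The profile `e^{-x}` as an element of `L¹_1`. -/
def expProfile : WeightedL1 1 := integrable_exp_neg_weightMeasure_one.toL1 _

theorem expProfile_ae_eq : expProfile =ᵐ[halfLine] fun x => Real.exp (-x) :=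
  (ae_weightMeasure_iff 1).1 integrable_exp_neg_weightMeasure_one.coeFn_toL1

theorem isUnitMassDensity_expProfile : IsUnitMassDensity expProfile := by
  have h1 : (fun x => x * expProfile x) =ᵐ[halfLine] fun x => x ^ 1 * Real.exp (-x) := by
    filter_upwards [expProfile_ae_eq] with x hx
    rw [hx, pow_one]
  refine ⟨?_, (integrable_congr h1).2 (integrable_pow_mul_exp_neg 1), ?_⟩
  · filter_upwards [expProfile_ae_eq] with x hx
    rw [hx]
    positivity
  · rw [integral_congr_ae h1]
    have := Real.Gamma_eq_integral (s := 2) (by norm_num)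
    rw [Real.Gamma_two] at this
    rw [this, halfLine]
    refine setIntegral_congr_fun measurableSet_Ioi fun x _ => ?_
    norm_num [mul_comm]

theorem coagProfileCurve_ae_eq_dilation {r : ℝ} (hr : 0 ≤ r) :
    coagProfileCurve r =ᵐ[halfLine]
      dilation r (coagulation (fun _ _ => 2) (expProfile : ℝ → ℝ)) := by
  have hi := WeightedL1.integrable zero_le_one expProfile
  refine (coagProfileCurve_ae_eq hr).trans ?_
  refine (dilation_congr (integrable_coagulation_two hi)
    ((coagulation_two_congr hi expProfile_ae_eq).trans
    (ae_of_all _ coagulation_exp_neg)) r).symm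

theorem halfFourier_expProfile (ξ : ℝ) :
    halfFourier expProfile ξ = (1 + ξ * Complex.I)⁻¹ := by
  rw [halfFourier_congr expProfile_ae_eq, halfFourier_exp_neg]

theorem halfFourier_coagProfileCurve {r : ℝ} (hr : 0 ≤ r) (ξ : ℝ) :
    halfFourier (coagProfileCurve r) ξ = Real.exp r *
      ((1 + (Real.exp (-r) * ξ : ℝ) * Complex.I)⁻¹ ^ 2 -
        2 * (1 + (Real.exp (-r) * ξ : ℝ) * Complex.I)⁻¹) := by
  have hi := WeightedL1.integrable zero_le_one expProfile
  rw [halfFourier_congr (coagProfileCurve_ae_eq_dilation hr), halfFourier_dilation,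
    halfFourier_coagulation_two hi, halfFourier_expProfile, halfFourier_expProfile]
  simp

/-- The derivative in s of the transform of S_{t-s}G⁰ is the transform of S_{t-s}𝒞(G⁰,G⁰), which
makes the Duhamel integral of the constant curve telescope. -/
theorem hasDerivAt_scaled_halfFourier_exp_neg (t ξ s : ℝ) :
    HasDerivAt (fun s : ℝ => (Real.exp (t - s) : ℂ) * (1 + (Real.exp (-(t - s)) * ξ : ℝ) *
      Complex.I)⁻¹) (Real.exp (t - s) * ((1 + (Real.exp (-(t - s)) * ξ : ℝ) * Complex.I)⁻¹ ^ 2 -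
        2 * (1 + (Real.exp (-(t - s)) * ξ : ℝ) * Complex.I)⁻¹)) s := by
  have hs : HasDerivAt (fun s : ℝ => t - s) (-1) s := (hasDerivAt_id s).const_sub t
  have h1 : HasDerivAt (fun s : ℝ => (Real.exp (t - s) : ℂ)) ((Real.exp (t - s) * -1 : ℝ) : ℂ) s :=
    hs.exp.ofReal_comp
  have h2 : HasDerivAt (fun s : ℝ => (1 + (Real.exp (-(t - s)) * ξ : ℝ) * Complex.I : ℂ))
      ((Real.exp (-(t - s)) * -(-1) * ξ : ℝ) * Complex.I) s :=
    (((hs.neg.exp.mul_const ξ).ofReal_comp).mul_const _).const_add 1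
  have hne := one_add_mul_I_ne_zero (Real.exp (-(t - s)) * ξ)
  have h3 : HasDerivAt (fun s : ℝ => (1 + (Real.exp (-(t - s)) * ξ : ℝ) * Complex.I : ℂ)⁻¹) _ s :=
    h2.inv hne
  refine (h1.mul h3).congr_deriv ?_
  set e := Real.exp (t - s)
  set z := Real.exp (-(t - s)) * ξ
  have hz : ((Real.exp (-(t - s)) * -(-1) * ξ : ℝ) : ℂ) = z := by
    congr 1
    ring
  rw [hz]
  push_cast
  field_simp
  ring

theorem isProfile_expProfile : IsProfile (fun _ _ => 2) expProfile := by
  refine ⟨continuousOn_const, fun t ht => ?_⟩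
  have hint : IntervalIntegrable (fun s => coagProfileCurve (t - s)) volume 0 t := by
    refine ContinuousOn.intervalIntegrable ?_
    rw [uIcc_of_le ht]
    exact (continuousOn_coagProfileCurve t).comp (by fun_prop) fun s hs =>
      ⟨sub_nonneg.2 hs.2, sub_le_self _ hs.1⟩
  refine ⟨fun s => coagProfileCurve (t - s), fun s hs =>
    coagProfileCurve_ae_eq_dilation (sub_nonneg.2 hs.2), hint, ?_⟩
  have hi := WeightedL1.integrable zero_le_one expProfile
  have hi' := WeightedL1.integrable zero_le_one (∫ s in (0 : ℝ)..t, coagProfileCurve (t - s))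
  refine ae_eq_of_halfFourier_eq hi ((integrable_dilation hi t).add hi') fun ξ => ?_
  rw [halfFourier_add (integrable_dilation hi t) hi', halfFourier_dilation,
    halfFourier_expProfile, halfFourier_expProfile, ← halfFourierCLM_apply zero_le_one,
    ← ContinuousLinearMap.intervalIntegral_comp_comm _ hint]
  have hLint : IntervalIntegrable
      (fun s => halfFourierCLM zero_le_one ξ (coagProfileCurve (t - s))) volume 0 t := by
    rw [intervalIntegrable_iff] at hint ⊢
    exact (halfFourierCLM zero_le_one ξ).integrable_comp hint
  have hFTC := intervalIntegral.integral_eq_sub_of_hasDerivAt (fun s hs =>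
    (hasDerivAt_scaled_halfFourier_exp_neg t ξ s).congr_deriv
      (halfFourier_coagProfileCurve (sub_nonneg.2 (uIcc_of_le ht ▸ hs).2) ξ).symm) hLint
  simp only [halfFourierCLM_apply]
  rw [hFTC]
  simp

/-! ### Uniqueness of the profile -/

theorem hasDerivAt_halfFourier_zero {g : ℝ → ℝ} (hg : Integrable g halfLine)
    (hg1 : Integrable (fun x => x * g x) halfLine) (ξ : ℝ) :
    HasDerivAt (fun s : ℝ => halfFourier g (s * ξ))
      (-(ξ * (∫ x, x * g x ∂halfLine : ℝ)) * Complex.I) 0 := by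
  have hd : ∀ x s : ℝ, HasDerivAt
      (fun s : ℝ => Complex.exp (-(s * ξ * x : ℝ) * Complex.I) * g x)
      (Complex.exp (-(s * ξ * x : ℝ) * Complex.I) * (-(ξ * (x * g x : ℝ)) * Complex.I)) s := by
    intro x s
    have h1 : HasDerivAt (fun s : ℝ => (-(s * ξ * x : ℝ) * Complex.I : ℂ))
        (-(1 * ξ * x : ℝ) * Complex.I) s :=
      ((((hasDerivAt_id s).mul_const ξ).mul_const x).ofReal_comp.neg).mul_const _
    refine (h1.cexp.mul_const _).congr_deriv ?_
    push_cast
    ring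
  have key := (hasDerivAt_integral_of_dominated_loc_of_deriv_le (μ := halfLine) (x₀ := (0 : ℝ))
    (s := univ) (F := fun (s : ℝ) x => Complex.exp (-(s * ξ * x : ℝ) * Complex.I) * g x)
    (F' := fun (s : ℝ) x => Complex.exp (-(s * ξ * x : ℝ) * Complex.I) *
      (-(ξ * (x * g x : ℝ)) * Complex.I))
    (bound := fun x => ‖ξ‖ * ‖x * g x‖) univ_mem
    (Eventually.of_forall fun s => (integrable_halfFourier_kernel (g := fun x => (g x : ℂ))
      hg.ofReal _).1) (integrable_halfFourier_kernel (g := fun x => (g x : ℂ)) hg.ofReal _)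
    (AEStronglyMeasurable.mul (by fun_prop)
      (((hg1.ofReal (𝕜 := ℂ)).const_mul _).neg.mul_const _).1)
    (ae_of_all _ fun x s _ => by
      rw [norm_halfFourier_kernel, norm_mul, norm_neg, norm_mul, Complex.norm_I, mul_one,
        Complex.norm_real, Complex.norm_real])
    (hg1.norm.const_mul _) (ae_of_all _ fun x s _ => hd x s)).2
  refine key.congr_deriv ?_
  simp only [zero_mul, Complex.ofReal_zero, neg_zero, Complex.exp_zero, one_mul]
  rw [integral_mul_const, integral_neg, integral_const_mul, integral_complex_ofReal]

theorem integral_pos_of_isUnitMassDensity {g : ℝ → ℝ} (hg : Integrable g halfLine)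
    (h : IsUnitMassDensity g) : 0 < ∫ x, g x ∂halfLine := by
  refine lt_of_le_of_ne (integral_nonneg_of_ae h.1) fun h0 => ?_
  have h1 := (integral_eq_zero_iff_of_nonneg_ae h.1 hg).1 h0.symm
  have h2 : ∫ x, x * g x ∂halfLine = 0 := by
    refine integral_eq_zero_of_ae ?_
    filter_upwards [h1] with x hx
    simp [hx]
  rw [h.2.2] at h2
  exact one_ne_zero h2

theorem halfFourier_of_isProfile {G : WeightedL1 1} (h : IsProfile (fun _ _ => 2) G)
    (hu : IsUnitMassDensity G) (ξ : ℝ) : halfFourier G ξ = (1 + ξ * Complex.I)⁻¹ := by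
  have hi := WeightedL1.integrable zero_le_one G
  have hm : halfFourier G 0 = 1 := by
    -- Time log 2 makes e^t = 2, and the equation reads m(1 + m) = 2m. Unit mass excludes m = 0.
    have h1 := IsMildSolution.halfFourier_zero_riccati zero_le_one h
      (Real.log_nonneg one_le_two)
    rw [Real.exp_neg, Real.exp_log two_pos] at h1
    have h2 : halfFourier G 0 ≠ 0 := by
      rw [halfFourier_zero, Complex.ofReal_ne_zero]
      exact (integral_pos_of_isUnitMassDensity hi hu).ne'
    apply mul_left_cancel₀ h2
    push_cast at h1
    linear_combination 2 * h1
  have hd := hasDerivAt_halfFourier_zero hi hu.2.1 ξ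
  rw [hu.2.2] at hd
  have hσ := hd.tendsto_slope_zero_right
  simp only [zero_add, zero_mul, hm] at hσ
  have hs : Tendsto (fun s : ℝ => (s : ℂ)) (𝓝[>] 0) (𝓝 0) :=
    (Complex.continuous_ofReal.tendsto' 0 0 (by simp)).mono_left nhdsWithin_le_nhds
  have hl := ((tendsto_const_nhds (x := (1 : ℂ))).sub (hσ.sub (hs.mul hσ))).const_mul
    (1 - halfFourier G ξ)
  -- The Riccati identity at time -log s with w = sξ, divided by s. As s → 0 the difference quotient
  -- tends to -iξ, and the identity becomes (1 - Ĝ(ξ))(1 + iξ) = iξ.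
  have heq : (fun s : ℝ => (1 - halfFourier G ξ) * (1 - (s⁻¹ • (halfFourier G (s * ξ) - 1) -
      s * s⁻¹ • (halfFourier G (s * ξ) - 1)))) =ᶠ[𝓝[>] 0]
      fun s : ℝ => -(s⁻¹ • (halfFourier G (s * ξ) - 1)) := by
    filter_upwards [Ioo_mem_nhdsGT (zero_lt_one (α := ℝ))] with s hs
    have h1 := IsMildSolution.halfFourier_riccati zero_le_one h (t := -Real.log s)
      (neg_nonneg.2 (Real.log_nonpos hs.1.le hs.2.le)) (s * ξ)
    have hs0 : (s : ℂ) ≠ 0 := by exact_mod_cast hs.1.ne'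
    rw [neg_neg, Real.exp_neg, Real.exp_log hs.1, inv_mul_cancel_left₀ hs.1.ne', hm] at h1
    rw [Complex.real_smul]
    push_cast at h1 ⊢
    field_simp at h1 ⊢
    linear_combination h1
  have := tendsto_nhds_unique (hl.congr' heq) hσ.neg
  simp only [Complex.ofReal_one, mul_one, zero_mul, sub_zero] at this
  refine eq_inv_of_mul_eq_one_left ?_
  linear_combination -this

theorem eq_expProfile_of_isProfile {G : WeightedL1 1} (h : IsProfile (fun _ _ => 2) G)
    (hu : IsUnitMassDensity G) : G = expProfile := by
  refine Lp.ext ((ae_weightMeasure_iff 1).2 ?_)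
  refine ae_eq_of_halfFourier_eq (WeightedL1.integrable zero_le_one G)
    (WeightedL1.integrable zero_le_one _) fun ξ => ?_
  rw [halfFourier_of_isProfile h hu, halfFourier_expProfile]
end

/-! ### Non-concentration: a lower bound for ∫(1 - cos(ηx)) g -/

noncomputable section

theorem continuous_inv_one_add_one_sub_cos {N : ℝ} (hN : 0 ≤ N) :
    Continuous fun y : ℝ => (1 + N * (1 - Real.cos y))⁻¹ := by
  refine Continuous.inv₀ (by fun_prop) fun y => ?_
  have := mul_nonneg hN (sub_nonneg.2 (Real.cos_le_one y))
  positivity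

theorem inv_one_add_one_sub_cos_nonneg {N : ℝ} (hN : 0 ≤ N) (y : ℝ) :
    0 ≤ (1 + N * (1 - Real.cos y))⁻¹ := by
  have := mul_nonneg hN (sub_nonneg.2 (Real.cos_le_one y))
  positivity

theorem inv_one_add_one_sub_cos_le_one {N : ℝ} (hN : 0 ≤ N) (y : ℝ) :
    (1 + N * (1 - Real.cos y))⁻¹ ≤ 1 := by
  have := mul_nonneg hN (sub_nonneg.2 (Real.cos_le_one y))
  exact inv_le_one_of_one_le₀ (by linarith)

/-- On a period 1 - cos y ≥ 2y²/π², so the integrand lies below a Cauchy density of width π/L; the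
arctangents contribute at most π, and π² ≤ 10. -/
theorem integral_period_inv_one_add_one_sub_cos_le {L : ℝ} (hL : 0 < L) :
    ∫ y in -Real.pi..Real.pi, (1 + L ^ 2 * (1 - Real.cos y))⁻¹ ≤ 10 / L := by
  have hπ := Real.pi_pos
  have hc : 0 < L / Real.pi := by positivity
  calc ∫ y in -Real.pi..Real.pi, (1 + L ^ 2 * (1 - Real.cos y))⁻¹
      ≤ ∫ y in -Real.pi..Real.pi, (1 + (L / Real.pi * y) ^ 2)⁻¹ := by
        refine intervalIntegral.integral_mono_on (by linarith)
          ((continuous_inv_one_add_one_sub_cos (sq_nonneg L)).intervalIntegrable _ _)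
          (Continuous.intervalIntegrable (Continuous.inv₀ (by fun_prop) fun y => by positivity) _ _)
          fun y hy => ?_
        have h1 := Real.cos_le_one_sub_mul_cos_sq (abs_le.2 hy)
        have h2 : 2 / Real.pi ^ 2 * y ^ 2 = 2 * (y / Real.pi) ^ 2 := by ring
        have h3 : (L / Real.pi * y) ^ 2 = L ^ 2 * (y / Real.pi) ^ 2 := by ring
        rw [h2] at h1
        rw [h3]
        gcongr
        nlinarith [sq_nonneg (y / Real.pi)]
    _ = (L / Real.pi)⁻¹ * (Real.arctan (L / Real.pi * Real.pi) -
          Real.arctan (L / Real.pi * -Real.pi)) := by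
        rw [intervalIntegral.integral_comp_mul_left (fun y => (1 + y ^ 2)⁻¹) hc.ne',
          integral_inv_one_add_sq, smul_eq_mul]
    _ ≤ (L / Real.pi)⁻¹ * Real.pi := by
        gcongr
        linarith [Real.arctan_lt_pi_div_two (L / Real.pi * Real.pi),
          Real.neg_pi_div_two_lt_arctan (L / Real.pi * -Real.pi)]
    _ = Real.pi ^ 2 / L := by field_simp
    _ ≤ 10 / L := by
        gcongr
        nlinarith [Real.pi_lt_d2]

theorem integral_inv_one_add_one_sub_cos_le {L T : ℝ} (hL : 0 < L) (hT : 0 ≤ T) :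
    ∫ y in (0 : ℝ)..T, (1 + L ^ 2 * (1 - Real.cos y))⁻¹ ≤ (T / (2 * Real.pi) + 1) * (10 / L) := by
  have hπ := Real.two_pi_pos
  have hc := continuous_inv_one_add_one_sub_cos (sq_nonneg L)
  have hper : Function.Periodic (fun y : ℝ => (1 + L ^ 2 * (1 - Real.cos y))⁻¹)
      (2 * Real.pi) := fun y => by simp only [Real.cos_add_two_pi]
  set n := ⌈T / (2 * Real.pi)⌉₊
  have hn : T ≤ n * (2 * Real.pi) := (div_le_iff₀ hπ).1 (Nat.le_ceil _)
  have hn' : (n : ℝ) ≤ T / (2 * Real.pi) + 1 := (Nat.ceil_lt_add_one (by positivity)).le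
  calc ∫ y in (0 : ℝ)..T, (1 + L ^ 2 * (1 - Real.cos y))⁻¹
      ≤ ∫ y in (0 : ℝ)..n * (2 * Real.pi), (1 + L ^ 2 * (1 - Real.cos y))⁻¹ :=
        intervalIntegral.integral_mono_interval le_rfl hT hn
          (ae_of_all _ fun y => inv_one_add_one_sub_cos_nonneg (sq_nonneg L) y)
          (hc.intervalIntegrable _ _)
    _ = n * ∫ y in -Real.pi..Real.pi, (1 + L ^ 2 * (1 - Real.cos y))⁻¹ := by
        have h1 := hper.intervalIntegral_add_zsmul_eq n 0 fun _ _ => hc.intervalIntegrable _ _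
        have h2 := hper.intervalIntegral_add_eq 0 (-Real.pi)
        rw [h2, show -Real.pi + 2 * Real.pi = Real.pi by ring] at h1
        simpa using h1
    _ ≤ (T / (2 * Real.pi) + 1) * (10 / L) := by
        refine mul_le_mul hn' (integral_period_inv_one_add_one_sub_cos_le hL) ?_ (by positivity)
        exact intervalIntegral.integral_nonneg (by linarith [Real.pi_pos]) fun y _ =>
          inv_one_add_one_sub_cos_nonneg (sq_nonneg L) y

theorem integral_scaled_inv_one_add_one_sub_cos_le {L R η : ℝ} (hL : 0 < L) (hR : 0 ≤ R)
    (hη : η ≠ 0) : ∫ x in (0 : ℝ)..R, (1 + L ^ 2 * (1 - Real.cos (η * x)))⁻¹ ≤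
      (R / (2 * Real.pi) + 1 / |η|) * (10 / L) := by
  have hη' := abs_pos.2 hη
  have h1 : ∀ x : ℝ, Real.cos (η * x) = Real.cos (|η| * x) := fun x => by
    rcases abs_choice η with h | h <;> simp [h]
  simp_rw [h1]
  rw [intervalIntegral.integral_comp_mul_left
    (fun y => (1 + L ^ 2 * (1 - Real.cos y))⁻¹) hη'.ne', mul_zero, smul_eq_mul]
  calc |η|⁻¹ * ∫ y in (0 : ℝ)..|η| * R, (1 + L ^ 2 * (1 - Real.cos y))⁻¹
      ≤ |η|⁻¹ * ((|η| * R / (2 * Real.pi) + 1) * (10 / L)) := by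
        gcongr
        exact integral_inv_one_add_one_sub_cos_le hL (by positivity)
    _ = _ := by field_simp

/-- Densities on the half line with unit mass, whose `L²` norm is at most `A` and whose moments of
order zero and two are at most `B`. -/
structure HasMomentBounds (g : ℝ → ℝ) (A B : ℝ) : Prop where
  nonneg : ∀ᵐ x ∂halfLine, 0 ≤ g x
  integrable : Integrable g halfLine
  integrable_mul : Integrable (fun x => x * g x) halfLine
  integral_mul : ∫ x, x * g x ∂halfLine = 1
  integrable_sq_mul : Integrable (fun x => x ^ 2 * g x) halfLine
  integrable_sq : Integrable (fun x => g x ^ 2) halfLine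
  integral_sq_le : ∫ x, g x ^ 2 ∂halfLine ≤ A ^ 2
  one_le : 1 ≤ B
  integral_le : ∫ x, g x ∂halfLine ≤ B
  integral_sq_mul_le : ∫ x, x ^ 2 * g x ∂halfLine ≤ B

namespace HasMomentBounds

variable {g : ℝ → ℝ} {A B : ℝ}

/-- Integrate 2x ≤ B + x²/B against g: the left side is twice the unit mass, and the second moment
contributes at most 1. -/
theorem inv_le_integral (h : HasMomentBounds g A B) : B⁻¹ ≤ ∫ x, g x ∂halfLine := by
  have hB : 0 < B := zero_lt_one.trans_le h.one_le
  have h1 : ∫ x, 2 * (x * g x) ∂halfLine ≤ ∫ x, (B * g x + B⁻¹ * (x ^ 2 * g x)) ∂halfLine := by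
    refine integral_mono_ae (h.integrable_mul.const_mul 2)
      ((h.integrable.const_mul B).add (h.integrable_sq_mul.const_mul _)) ?_
    filter_upwards [h.nonneg] with x hx
    have h2 : 2 * x ≤ B + B⁻¹ * x ^ 2 := by
      have : B + B⁻¹ * x ^ 2 - 2 * x = B⁻¹ * (B - x) ^ 2 := by field_simp; ring
      have : 0 ≤ B⁻¹ * (B - x) ^ 2 := by positivity
      linarith
    calc 2 * (x * g x) = 2 * x * g x := by ring
      _ ≤ (B + B⁻¹ * x ^ 2) * g x := by gcongr
      _ = _ := by ring
  rw [integral_const_mul, h.integral_mul, integral_add (h.integrable.const_mul B)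
    (h.integrable_sq_mul.const_mul _), integral_const_mul, integral_const_mul] at h1
  have h3 : B⁻¹ * ∫ x, x ^ 2 * g x ∂halfLine ≤ B⁻¹ * B := by
    gcongr
    exact h.integral_sq_mul_le
  rw [inv_mul_cancel₀ hB.ne'] at h3
  rw [inv_le_iff_one_le_mul₀' hB]
  linarith

/-- Integrable functions with bounded second moment and `L²` norm do not concentrate on the
zeros of `1 - cos (η x)`. -/
theorem inv_le_integral_one_sub_cos (h : HasMomentBounds g A B) {η : ℝ}
    (hη : (4 * B)⁻¹ ≤ |η|) : (2 * B * (800 * B ^ 3 * (A ^ 2 + 1)) ^ 2)⁻¹ ≤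
      ∫ x, (1 - Real.cos (η * x)) * g x ∂halfLine := by
  have hB1 := h.one_le
  have hB : 0 < B := zero_lt_one.trans_le h.one_le
  have hη0 : η ≠ 0 := fun h0 => by
    rw [h0, abs_zero] at hη
    exact absurd hη (not_le.2 (by positivity))
  set L := 800 * B ^ 3 * (A ^ 2 + 1) with hLdef
  have hL : 0 < L := by positivity
  -- ψ is a smooth substitute for the indicator of the set where 1 - cos(ηx) is below about L^{-2}:
  -- it satisfies 1 ≤ L²(1 - cos) + ψ and has integral O(1/L) on [0, 2B].
  set ψ : ℝ → ℝ := fun x => (1 + L ^ 2 * (1 - Real.cos (η * x)))⁻¹ with hψ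
  have hψc : Continuous ψ :=
    (continuous_inv_one_add_one_sub_cos (sq_nonneg L)).comp (continuous_const.mul continuous_id)
  have hψ0 : ∀ x, 0 ≤ ψ x := fun x => inv_one_add_one_sub_cos_nonneg (sq_nonneg L) _
  have hψ1 : ∀ x, ψ x ≤ 1 := fun x => inv_one_add_one_sub_cos_le_one (sq_nonneg L) _
  have hψ2 : ∀ x, 1 ≤ L ^ 2 * (1 - Real.cos (η * x)) + ψ x := fun x => by
    have hs : 0 ≤ L ^ 2 * (1 - Real.cos (η * x)) :=
      mul_nonneg (sq_nonneg L) (sub_nonneg.2 (Real.cos_le_one _))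
    have : (1 + L ^ 2 * (1 - Real.cos (η * x))) * ψ x = 1 := mul_inv_cancel₀ (by positivity)
    nlinarith [hψ1 x]
  -- θ is the weight in Young's inequality ψg ≤ θg²/2 + ψ²/(2θ). With this choice and that of L,
  -- these two terms contribute at most 1/(8B) each and the tail beyond 2B at most 1/(4B), half of
  -- the lower bound 1/B for ∫g.
  set θ := (4 * B * (A ^ 2 + 1))⁻¹ with hθdef
  have hθ : 0 < θ := by positivity
  have hcosi : Integrable (fun x => (1 - Real.cos (η * x)) * g x) halfLine := by
    refine h.integrable.bdd_mul (c := 2) (Continuous.aestronglyMeasurable (by fun_prop)) ?_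
    refine ae_of_all _ fun x => ?_
    rw [Real.norm_eq_abs, abs_le]
    constructor <;> linarith [Real.cos_le_one (η * x), Real.neg_one_le_cos (η * x)]
  have hres : halfLine.restrict (Iic (2 * B)) = volume.restrict (Ioc 0 (2 * B)) := by
    rw [halfLine, Measure.restrict_restrict measurableSet_Iic, inter_comm, Ioi_inter_Iic]
  have hψi : Integrable ((Iic (2 * B)).indicator ψ) halfLine := by
    rw [integrable_indicator_iff measurableSet_Iic, IntegrableOn, hres]
    exact hψc.integrableOn_Ioc
  have hψint : ∫ x, (Iic (2 * B)).indicator ψ x ∂halfLine ≤ 5 * B * (10 / L) := by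
    rw [integral_indicator measurableSet_Iic, hres,
      ← intervalIntegral.integral_of_le (by positivity)]
    refine (integral_scaled_inv_one_add_one_sub_cos_le hL (by positivity) hη0).trans ?_
    have h1 : 1 / |η| ≤ 4 * B := by
      rw [one_div]
      exact inv_le_of_inv_le₀ (by positivity) hη
    have h2 : 2 * B / (2 * Real.pi) ≤ B := by
      rw [div_le_iff₀ Real.two_pi_pos]
      nlinarith [Real.pi_gt_three]
    gcongr
    linarith
  have j1 : Integrable (fun x => L ^ 2 * ((1 - Real.cos (η * x)) * g x)) halfLine :=
    hcosi.const_mul _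
  have j2 : Integrable (fun x => θ / 2 * g x ^ 2) halfLine := h.integrable_sq.const_mul _
  have j3 : Integrable (fun x => (2 * θ)⁻¹ * (Iic (2 * B)).indicator ψ x) halfLine :=
    hψi.const_mul _
  have j4 : Integrable (fun x => ((2 * B) ^ 2)⁻¹ * (x ^ 2 * g x)) halfLine :=
    h.integrable_sq_mul.const_mul _
  have j34 : Integrable (fun x => (2 * θ)⁻¹ * (Iic (2 * B)).indicator ψ x +
      ((2 * B) ^ 2)⁻¹ * (x ^ 2 * g x)) halfLine := j3.add j4
  have j234 : Integrable (fun x => θ / 2 * g x ^ 2 + ((2 * θ)⁻¹ * (Iic (2 * B)).indicator ψ x +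
      ((2 * B) ^ 2)⁻¹ * (x ^ 2 * g x))) halfLine := j2.add j34
  have hmain : ∫ x, g x ∂halfLine ≤ ∫ x, (L ^ 2 * ((1 - Real.cos (η * x)) * g x) +
      (θ / 2 * g x ^ 2 + ((2 * θ)⁻¹ * (Iic (2 * B)).indicator ψ x +
        ((2 * B) ^ 2)⁻¹ * (x ^ 2 * g x)))) ∂halfLine := by
    refine integral_mono_ae h.integrable (j1.add j234) ?_
    filter_upwards [h.nonneg, ae_halfLine_pos] with x hx hx0
    have hc : 0 ≤ L ^ 2 * ((1 - Real.cos (η * x)) * g x) :=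
      mul_nonneg (sq_nonneg L) (mul_nonneg (sub_nonneg.2 (Real.cos_le_one _)) hx)
    -- Young's inequality is used for x ≤ 2B, Chebyshev's inequality with the second moment beyond.
    by_cases hxB : x ≤ 2 * B
    · rw [indicator_of_mem (show x ∈ Iic (2 * B) from hxB)]
      have h1 : g x ≤ (L ^ 2 * (1 - Real.cos (η * x)) + ψ x) * g x :=
        le_mul_of_one_le_left hx (hψ2 x)
      have h2 : ψ x * g x ≤ θ / 2 * g x ^ 2 + (2 * θ)⁻¹ * ψ x := by
        have h3 : θ / 2 * g x ^ 2 + (2 * θ)⁻¹ * ψ x ^ 2 - ψ x * g x =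
            (2 * θ)⁻¹ * (θ * g x - ψ x) ^ 2 := by field_simp; ring
        have h4 : 0 ≤ (2 * θ)⁻¹ * (θ * g x - ψ x) ^ 2 := by positivity
        have h5 : (2 * θ)⁻¹ * ψ x ^ 2 ≤ (2 * θ)⁻¹ * ψ x := by
          gcongr
          nlinarith [hψ0 x, hψ1 x]
        linarith
      have h6 : 0 ≤ ((2 * B) ^ 2)⁻¹ * (x ^ 2 * g x) := by positivity
      nlinarith
    · rw [indicator_of_notMem (show x ∉ Iic (2 * B) from hxB), mul_zero, zero_add]
      have h1 : g x ≤ ((2 * B) ^ 2)⁻¹ * (x ^ 2 * g x) := by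
        rw [← mul_assoc]
        refine le_mul_of_one_le_left hx ?_
        rw [inv_mul_eq_div, one_le_div (by positivity)]
        exact pow_le_pow_left₀ (by positivity) (not_le.1 hxB).le 2
      have h2 : 0 ≤ θ / 2 * g x ^ 2 := by positivity
      linarith
  rw [integral_add j1 j234, integral_add j2 j34, integral_add j3 j4, integral_const_mul,
    integral_const_mul, integral_const_mul, integral_const_mul] at hmain
  have e1 : θ / 2 * ∫ x, g x ^ 2 ∂halfLine ≤ B⁻¹ / 8 := by
    calc θ / 2 * ∫ x, g x ^ 2 ∂halfLine ≤ θ / 2 * (A ^ 2 + 1) := by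
          gcongr
          linarith [h.integral_sq_le]
      _ = B⁻¹ / 8 := by
          rw [hθdef]
          field_simp
          norm_num
  have e2 : (2 * θ)⁻¹ * ∫ x, (Iic (2 * B)).indicator ψ x ∂halfLine ≤ B⁻¹ / 8 := by
    calc (2 * θ)⁻¹ * ∫ x, (Iic (2 * B)).indicator ψ x ∂halfLine
        ≤ (2 * θ)⁻¹ * (5 * B * (10 / L)) := by gcongr
      _ = B⁻¹ / 8 := by
          rw [hθdef, hLdef]
          field_simp
          norm_num
  have e3 : ((2 * B) ^ 2)⁻¹ * ∫ x, x ^ 2 * g x ∂halfLine ≤ B⁻¹ / 4 := by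
    calc ((2 * B) ^ 2)⁻¹ * ∫ x, x ^ 2 * g x ∂halfLine ≤ ((2 * B) ^ 2)⁻¹ * B := by
          gcongr
          exact h.integral_sq_mul_le
      _ = B⁻¹ / 4 := by
          field_simp
          norm_num
  have e4 := h.inv_le_integral
  have e5 : B⁻¹ / 2 ≤ L ^ 2 * ∫ x, (1 - Real.cos (η * x)) * g x ∂halfLine := by linarith
  calc (2 * B * L ^ 2)⁻¹ = (L ^ 2)⁻¹ * (B⁻¹ / 2) := by field_simp
    _ ≤ (L ^ 2)⁻¹ * (L ^ 2 * ∫ x, (1 - Real.cos (η * x)) * g x ∂halfLine) := by gcongr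
    _ = _ := by rw [inv_mul_cancel_left₀ (by positivity)]

end HasMomentBounds

/-! ### Taylor bounds for the Fourier transform at frequency zero -/

theorem norm_one_sub_exp_neg_mul_I_le (y : ℝ) :
    ‖1 - Complex.exp (-(y : ℂ) * Complex.I)‖ ≤ |y| := by
  rw [norm_sub_rev, ← Complex.ofReal_neg, mul_comm]
  simpa using Real.norm_exp_I_mul_ofReal_sub_one_le (x := -y)

theorem norm_one_sub_exp_neg_mul_I_sub_le (y : ℝ) :
    ‖1 - Complex.exp (-(y : ℂ) * Complex.I) - y * Complex.I‖ ≤ 2 * y ^ 2 := by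
  by_cases hy : |y| ≤ 1
  · have h := Complex.norm_exp_sub_one_sub_id_le (x := -(y : ℂ) * Complex.I) (by simpa using hy)
    have e : Complex.exp (-(y : ℂ) * Complex.I) - 1 - -(y : ℂ) * Complex.I =
        -(1 - Complex.exp (-(y : ℂ) * Complex.I) - y * Complex.I) := by ring
    rw [e, norm_neg, norm_mul, norm_neg, Complex.norm_I, Complex.norm_real, mul_one,
      Real.norm_eq_abs, sq_abs] at h
    nlinarith [sq_nonneg y]
  -- For |y| > 1 the trivial bound 2|y| is already below 2y².
  · have h1 := norm_one_sub_exp_neg_mul_I_le y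
    have h2 : ‖(y : ℂ) * Complex.I‖ = |y| := by simp
    have h3 := norm_sub_le (1 - Complex.exp (-(y : ℂ) * Complex.I)) (y * Complex.I)
    rw [h2] at h3
    nlinarith [sq_abs y]

theorem halfFourier_zero_sub {g : ℝ → ℝ} (hg : Integrable g halfLine) (η : ℝ) :
    halfFourier g 0 - halfFourier g η =
      ∫ x, (1 - Complex.exp (-(η * x : ℝ) * Complex.I)) * g x ∂halfLine := by
  rw [halfFourier, halfFourier, ← integral_sub
    (integrable_halfFourier_kernel (g := fun x => (g x : ℂ)) hg.ofReal _)
    (integrable_halfFourier_kernel (g := fun x => (g x : ℂ)) hg.ofReal _)]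
  congr 1 with x
  simp [sub_mul]

theorem integrable_one_sub_exp_mul {g : ℝ → ℝ} (hg : Integrable g halfLine) (η : ℝ) :
    Integrable (fun x => (1 - Complex.exp (-(η * x : ℝ) * Complex.I)) * g x) halfLine := by
  have := (hg.ofReal (𝕜 := ℂ)).sub
    (integrable_halfFourier_kernel (g := fun x => (g x : ℂ)) hg.ofReal η)
  refine this.congr (ae_of_all _ fun x => ?_)
  simp [sub_mul]

theorem re_halfFourier_zero_sub {g : ℝ → ℝ} (hg : Integrable g halfLine) (η : ℝ) :
    (halfFourier g 0 - halfFourier g η).re =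
      ∫ x, (1 - Real.cos (η * x)) * g x ∂halfLine := by
  rw [halfFourier_zero_sub hg]
  refine (integral_re (integrable_one_sub_exp_mul hg η)).symm.trans ?_
  congr 1 with x
  have e : (Complex.exp (-(η * x : ℝ) * Complex.I)).re = Real.cos (η * x) := by
    rw [← Complex.ofReal_neg, Complex.exp_ofReal_mul_I_re, Real.cos_neg]
  rw [← e, ← Complex.one_re, ← Complex.sub_re, ← Complex.re_mul_ofReal]
  rfl

namespace HasMomentBounds

variable {g : ℝ → ℝ} {A B : ℝ}

theorem re_halfFourier_zero_sub_nonneg (h : HasMomentBounds g A B) (η : ℝ) :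
    0 ≤ (halfFourier g 0 - halfFourier g η).re := by
  rw [re_halfFourier_zero_sub h.integrable]
  refine integral_nonneg_of_ae ?_
  filter_upwards [h.nonneg] with x hx
    using mul_nonneg (sub_nonneg.2 (Real.cos_le_one _)) hx

theorem norm_halfFourier_zero_sub_le (h : HasMomentBounds g A B) (η : ℝ) :
    ‖halfFourier g 0 - halfFourier g η‖ ≤ |η| := by
  rw [halfFourier_zero_sub h.integrable]
  refine (norm_integral_le_of_norm_le (h.integrable_mul.const_mul |η|) ?_).trans_eq
    (by rw [integral_const_mul, h.integral_mul, mul_one])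
  filter_upwards [h.nonneg, ae_halfLine_pos] with x hx hx0
  rw [norm_mul, Complex.norm_real, Real.norm_of_nonneg hx, ← mul_assoc]
  gcongr
  simpa [abs_mul, abs_of_pos hx0] using norm_one_sub_exp_neg_mul_I_le (η * x)

theorem norm_halfFourier_zero_sub_sub_le (h : HasMomentBounds g A B) (η : ℝ) :
    ‖halfFourier g 0 - halfFourier g η - η * Complex.I‖ ≤ 2 * B * η ^ 2 := by
  have e1 : (η * Complex.I : ℂ) = ∫ x, (η * x : ℝ) * Complex.I * g x ∂halfLine := by
    have : ∀ x : ℝ, ((η * x : ℝ) : ℂ) * Complex.I * g x = η * Complex.I * (x * g x : ℝ) :=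
      fun x => by
        push_cast
        ring
    simp_rw [this]
    rw [integral_const_mul, integral_complex_ofReal, h.integral_mul]
    simp
  have hi : Integrable (fun x => ((η * x : ℝ) : ℂ) * Complex.I * g x) halfLine := by
    refine ((h.integrable_mul.ofReal (𝕜 := ℂ)).const_mul (η * Complex.I)).congr
      (ae_of_all _ fun x => ?_)
    simp
    ring
  rw [halfFourier_zero_sub h.integrable, e1,
    ← integral_sub (integrable_one_sub_exp_mul h.integrable η) hi]
  refine (norm_integral_le_of_norm_le (h.integrable_sq_mul.const_mul (2 * η ^ 2)) ?_).trans ?_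
  · filter_upwards [h.nonneg] with x hx
    rw [← sub_mul, norm_mul, Complex.norm_real, Real.norm_of_nonneg hx, ← mul_assoc]
    gcongr
    exact (norm_one_sub_exp_neg_mul_I_sub_le (η * x)).trans_eq (by ring)
  · rw [integral_const_mul]
    calc _ ≤ 2 * η ^ 2 * B := by
          gcongr
          exact h.integral_sq_mul_le
      _ = _ := by ring

end HasMomentBounds
end

/-! ### Pointwise comparison with the profile in frequency -/

noncomputable section

theorem one_add_mul_re_le_norm (φ : ℂ) (τ : ℝ) : 1 + τ * φ.re ≤ ‖1 + τ * φ‖ := by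
  simpa using Complex.re_le_norm (1 + τ * φ)

theorem mul_norm_le_norm_one_add_mul {φ : ℂ} (hφ : 0 ≤ φ.re) {τ : ℝ} (hτ : 0 ≤ τ) :
    τ * ‖φ‖ ≤ ‖1 + τ * φ‖ := by
  refine le_of_sq_le_sq ?_ (norm_nonneg _)
  rw [mul_pow, Complex.sq_norm, Complex.sq_norm, Complex.normSq_apply, Complex.normSq_apply]
  simp
  nlinarith [mul_nonneg hτ hφ]

theorem abs_le_norm_one_add_mul_I (x : ℝ) : |x| ≤ ‖(1 + x * Complex.I : ℂ)‖ := by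
  simpa using Complex.abs_im_le_norm (1 + x * Complex.I)

theorem mul_inv_le_one_add_sub_one_mul {a m b : ℝ} (ha : 1 ≤ a) (hb : 1 ≤ b) (hm : b⁻¹ ≤ m) :
    a * b⁻¹ ≤ 1 + (a - 1) * m := by
  have h1 : b⁻¹ ≤ 1 := inv_le_one_of_one_le₀ hb
  nlinarith

/-- Write am/(1+(a-1)m) = 1 + (m-1)/(1+(a-1)m) and 1/(1+aw) = 1 - aw/(1+aw). The ones cancel, and so
do the a² terms when the remaining fractions are combined; for w = iη the numerator φ - w + wφ is
quadratically small. -/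
theorem explicit_sub_profile_eq {a m φ w : ℂ} (h₁ : 1 + (a - 1) * m ≠ 0)
    (h₂ : 1 + (a - 1) * φ ≠ 0) (h₃ : 1 + a * w ≠ 0) :
    a * m / (1 + (a - 1) * m) - a * φ / (1 + (a - 1) * φ) - (1 + a * w)⁻¹ =
      (m - 1) / (1 + (a - 1) * m) -
        a * (φ - w + w * φ) / ((1 + (a - 1) * φ) * (1 + a * w)) := by
  obtain ⟨p, hp⟩ : ∃ p, p = 1 + (a - 1) * m := ⟨_, rfl⟩
  obtain ⟨q, hq⟩ : ∃ q, q = 1 + (a - 1) * φ := ⟨_, rfl⟩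
  obtain ⟨r, hr⟩ : ∃ r, r = 1 + a * w := ⟨_, rfl⟩
  rw [← hp] at h₁
  rw [← hq] at h₂
  rw [← hr] at h₃
  rw [← hp, ← hq, ← hr]
  field_simp
  rw [hp, hq, hr]
  ring

theorem explicit_eq {a m φ : ℂ} (h₁ : 1 + (a - 1) * m ≠ 0) (h₂ : 1 + (a - 1) * φ ≠ 0) :
    a * m / (1 + (a - 1) * m) - a * φ / (1 + (a - 1) * φ) =
      a * (m - φ) / ((1 + (a - 1) * m) * (1 + (a - 1) * φ)) := by
  rw [div_sub_div _ _ h₁ h₂]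
  ring

/-- Convergence of the explicit solution to the profile, for low frequencies. -/
theorem norm_explicit_sub_profile_le_of_low {a m B η : ℝ} {φ : ℂ} (ha : 1 ≤ a) (hB : 1 ≤ B)
    (hm : B⁻¹ ≤ m) (hm' : m ≤ B) (hφ : 0 ≤ φ.re) (hφη : ‖φ‖ ≤ |η|)
    (hφ2 : ‖φ - η * Complex.I‖ ≤ 2 * B * η ^ 2) (hη : |η| ≤ (4 * B)⁻¹) :
    ‖a * m / (1 + (a - 1) * m) - a * φ / (1 + (a - 1) * φ) -
      (1 + (a * η : ℝ) * Complex.I)⁻¹‖ ≤ 10 * B ^ 2 / a := by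
  have ha0 : 0 < a := zero_lt_one.trans_le ha
  have hB0 : 0 < B := zero_lt_one.trans_le hB
  have hm0 : 0 < m := (inv_pos.2 hB0).trans_le hm
  have hτ : 0 ≤ a - 1 := sub_nonneg.2 ha
  have hden1 := mul_inv_le_one_add_sub_one_mul ha hB hm
  have hden1' : 0 < 1 + (a - 1) * m := lt_of_lt_of_le (by positivity) hden1
  have hd := one_add_mul_re_le_norm φ (a - 1)
  have hd1 : 1 ≤ ‖1 + ((a - 1 : ℝ) : ℂ) * φ‖ := le_trans (by nlinarith [mul_nonneg hτ hφ]) hd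
  have hd2 := mul_norm_le_norm_one_add_mul hφ hτ
  have hne1 : (1 + (a - 1) * m : ℂ) ≠ 0 := by exact_mod_cast hden1'.ne'
  have hne2 : (1 + (a - 1) * φ : ℂ) ≠ 0 := by
    have := norm_pos_iff.1 (zero_lt_one.trans_le hd1)
    push_cast at this
    exact this
  have hne3 := one_add_mul_I_ne_zero (a * η)
  have hdec : a * m / (1 + (a - 1) * m) - a * φ / (1 + (a - 1) * φ) -
      (1 + (a * η : ℝ) * Complex.I)⁻¹ = ((m - 1) / (1 + (a - 1) * m) : ℝ) -
      a * (φ - η * Complex.I + η * Complex.I * φ) /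
        ((1 + ((a - 1 : ℝ) : ℂ) * φ) * (1 + (a * η : ℝ) * Complex.I)) := by
    rw [Complex.ofReal_mul, mul_assoc] at hne3
    have := explicit_sub_profile_eq hne1 hne2 hne3
    push_cast
    rw [mul_assoc (a : ℂ) (η : ℂ), this]
  have h4 : 4 * B * |η| ≤ 1 := by
    calc 4 * B * |η| ≤ 4 * B * (4 * B)⁻¹ := by gcongr
      _ = 1 := mul_inv_cancel₀ (by positivity)
  have hη0 := abs_nonneg η
  have hlow : |η| / 2 ≤ ‖φ‖ := by
    have h1 : ‖(η * Complex.I : ℂ)‖ = |η| := by simp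
    have h2 := norm_sub_norm_le (η * Complex.I : ℂ) φ
    rw [h1, norm_sub_rev] at h2
    nlinarith [sq_abs η]
  -- Combines the lower bounds 1 and (a-1)|η|/2 for the denominator, with |η| ≤ 1/4. The two
  -- denominators together then absorb the factor η² of the numerator.
  have hd3 : a * |η| / 3 ≤ ‖1 + ((a - 1 : ℝ) : ℂ) * φ‖ := by
    have h1 : (a - 1) * (|η| / 2) ≤ (a - 1) * ‖φ‖ := by gcongr
    nlinarith
  have hd4 : a * |η| ≤ ‖(1 + (a * η : ℝ) * Complex.I : ℂ)‖ := by
    simpa [abs_mul, abs_of_pos ha0] using abs_le_norm_one_add_mul_I (a * η)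
  have hnum : ‖φ - η * Complex.I + η * Complex.I * φ‖ ≤ 3 * B * η ^ 2 := by
    have h1 : ‖(η * Complex.I * φ : ℂ)‖ ≤ η ^ 2 := by
      rw [norm_mul, norm_mul, Complex.norm_I, Complex.norm_real, mul_one, Real.norm_eq_abs,
        ← sq_abs, sq]
      gcongr
    refine (norm_add_le _ _).trans ?_
    nlinarith [sq_nonneg η]
  have b1 : ‖(((m - 1) / (1 + (a - 1) * m) : ℝ) : ℂ)‖ ≤ B ^ 2 / a := by
    rw [Complex.norm_real, Real.norm_eq_abs, abs_div, abs_of_pos hden1']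
    calc |m - 1| / (1 + (a - 1) * m) ≤ B / (a * B⁻¹) := by
          gcongr
          rw [abs_le]
          constructor <;> linarith
      _ = B ^ 2 / a := by field_simp
  have b2 : ‖a * (φ - η * Complex.I + η * Complex.I * φ) /
        ((1 + ((a - 1 : ℝ) : ℂ) * φ) * (1 + (a * η : ℝ) * Complex.I))‖ ≤ 9 * B / a := by
    rw [norm_div, norm_mul, norm_mul, Complex.norm_real, Real.norm_of_nonneg ha0.le,
      div_le_iff₀ (mul_pos (norm_pos_iff.2 (by push_cast; exact hne2)) (norm_pos_iff.2 hne3))]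
    calc a * ‖φ - η * Complex.I + η * Complex.I * φ‖ ≤ a * (3 * B * η ^ 2) := by gcongr
      _ = 9 * B / a * (a * |η| / 3 * (a * |η|)) := by
          rw [← sq_abs η]
          field_simp
          ring
      _ ≤ _ := by gcongr
  rw [hdec]
  refine (norm_sub_le _ _).trans ((add_le_add b1 b2).trans ?_)
  rw [← add_div]
  gcongr
  nlinarith

/-- Convergence of the explicit solution to the profile, for high frequencies. -/
theorem norm_explicit_sub_profile_le_of_high {a m B η δ : ℝ} {φ : ℂ} (ha : 1 ≤ a) (hB : 1 ≤ B)
    (hm : B⁻¹ ≤ m) (hδ : 0 < δ) (hδ1 : δ ≤ 1) (hφ : δ ≤ φ.re) (hη : η ≠ 0) :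
    ‖a * m / (1 + (a - 1) * m) - a * φ / (1 + (a - 1) * φ) -
      (1 + (a * η : ℝ) * Complex.I)⁻¹‖ ≤ (B / δ * ‖m - φ‖ + |η|⁻¹) / a := by
  have ha0 : 0 < a := zero_lt_one.trans_le ha
  have hB0 : 0 < B := zero_lt_one.trans_le hB
  have hτ : 0 ≤ a - 1 := sub_nonneg.2 ha
  have hden1 := mul_inv_le_one_add_sub_one_mul ha hB hm
  have hden1' : 0 < 1 + (a - 1) * m := lt_of_lt_of_le (by positivity) hden1
  have hd : a * δ ≤ ‖1 + ((a - 1 : ℝ) : ℂ) * φ‖ :=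
    le_trans (by nlinarith) (one_add_mul_re_le_norm φ (a - 1))
  have hne1 : (1 + (a - 1) * m : ℂ) ≠ 0 := by exact_mod_cast hden1'.ne'
  have hne2 : (1 + (a - 1) * φ : ℂ) ≠ 0 := by
    have := norm_pos_iff.1 ((mul_pos ha0 hδ).trans_le hd)
    push_cast at this
    exact this
  have hdec : a * m / (1 + (a - 1) * m) - a * φ / (1 + (a - 1) * φ) =
      a * (m - φ) / ((1 + (a - 1) * m : ℝ) * (1 + ((a - 1 : ℝ) : ℂ) * φ)) := by
    rw [explicit_eq hne1 hne2]
    push_cast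
    rfl
  have hη' := abs_pos.2 hη
  rw [hdec]
  refine (norm_sub_le _ _).trans ?_
  rw [add_div]
  refine add_le_add ?_ ?_
  · rw [norm_div, norm_mul, norm_mul, Complex.norm_real, Complex.norm_real,
      Real.norm_of_nonneg ha0.le, Real.norm_of_nonneg hden1'.le]
    calc a * ‖(m : ℂ) - φ‖ / ((1 + (a - 1) * m) * ‖1 + ((a - 1 : ℝ) : ℂ) * φ‖)
        ≤ a * ‖(m : ℂ) - φ‖ / (a * B⁻¹ * (a * δ)) := by gcongr
      _ = _ := by field_simp
  · rw [norm_inv, ← one_div, ← one_div, div_div]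
    have := abs_le_norm_one_add_mul_I (a * η)
    rw [abs_mul, abs_of_pos ha0] at this
    rw [mul_comm |η|]
    gcongr

theorem sq_norm_explicit_sub_profile_le {a m A B η : ℝ} {φ : ℂ} (ha : 1 ≤ a) (hB : 1 ≤ B)
    (hm : B⁻¹ ≤ m) (hm' : m ≤ B) (hφ : 0 ≤ φ.re) (hφη : ‖φ‖ ≤ |η|)
    (hφ2 : ‖φ - η * Complex.I‖ ≤ 2 * B * η ^ 2)
    (hφ3 : (4 * B)⁻¹ ≤ |η| → (2 * B * (800 * B ^ 3 * (A ^ 2 + 1)) ^ 2)⁻¹ ≤ φ.re) :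
    ‖a * m / (1 + (a - 1) * m) - a * φ / (1 + (a - 1) * φ) -
      (1 + (a * η : ℝ) * Complex.I)⁻¹‖ ^ 2 ≤ (200 * B ^ 4 * (1 + η ^ 2)⁻¹ +
        8 * B ^ 4 * (800 * B ^ 3 * (A ^ 2 + 1)) ^ 4 * ‖m - φ‖ ^ 2) * (a ^ 2)⁻¹ := by
  have ha0 : 0 < a := zero_lt_one.trans_le ha
  have hB0 : 0 < B := zero_lt_one.trans_le hB
  have hB2 : 1 ≤ B ^ 2 := one_le_pow₀ hB
  set L := 800 * B ^ 3 * (A ^ 2 + 1)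
  have hL : 1 ≤ L := by
    have h1 : 1 ≤ B ^ 3 := one_le_pow₀ hB
    have h2 : 1 ≤ A ^ 2 + 1 := by nlinarith [sq_nonneg A]
    have := one_le_mul_of_one_le_of_one_le (by linarith : 1 ≤ 800 * B ^ 3) h2
    exact this
  have hL0 : 0 < L := zero_lt_one.trans_le hL
  rcases le_total |η| (4 * B)⁻¹ with h | h
  · have hb := norm_explicit_sub_profile_le_of_low ha hB hm hm' hφ hφη hφ2 h
    have h1 : η ^ 2 ≤ 1 := by
      rw [← sq_abs]
      exact pow_le_one₀ (abs_nonneg η) (h.trans (inv_le_one_of_one_le₀ (by linarith)))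
    have h2 : 1 ≤ 2 * (1 + η ^ 2)⁻¹ := by
      rw [← div_eq_mul_inv, one_le_div (by positivity)]
      linarith
    refine (pow_le_pow_left₀ (norm_nonneg _) hb 2).trans ?_
    rw [div_pow, div_eq_mul_inv]
    gcongr
    have h3 : 0 ≤ 8 * B ^ 4 * L ^ 4 * ‖(m : ℂ) - φ‖ ^ 2 := by positivity
    have h4 : 0 < B ^ 4 := by positivity
    nlinarith
  · have hη0 : 0 < |η| := lt_of_lt_of_le (by positivity) h
    have hb := norm_explicit_sub_profile_le_of_high ha hB hm (δ := (2 * B * L ^ 2)⁻¹)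
      (by positivity) (inv_le_one_of_one_le₀ (by nlinarith [one_le_pow₀ (n := 2) hL])) (hφ3 h)
      (abs_pos.1 hη0)
    refine (pow_le_pow_left₀ (norm_nonneg _) hb 2).trans ?_
    rw [div_pow, div_eq_mul_inv]
    gcongr
    -- From 1 ≤ 16B²η² and B ≥ 1, 1 + η² ≤ 17B²η².
    have h1 : |η|⁻¹ ^ 2 ≤ 17 * B ^ 2 * (1 + η ^ 2)⁻¹ := by
      rw [inv_pow, sq_abs, ← div_eq_mul_inv, le_div_iff₀ (by positivity), ← sq_abs,
        inv_mul_eq_div, div_le_iff₀ (by positivity)]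
      have h2 : 1 ≤ 4 * B * |η| := by
        calc 1 = 4 * B * (4 * B)⁻¹ := (mul_inv_cancel₀ (by positivity)).symm
          _ ≤ _ := by gcongr
      have h3 : 1 ≤ (4 * B * |η|) ^ 2 := one_le_pow₀ h2
      nlinarith [sq_nonneg |η|]
    have h4 : 0 ≤ (1 + η ^ 2)⁻¹ := by positivity
    have h5 : B / (2 * B * L ^ 2)⁻¹ * ‖(m : ℂ) - φ‖ = 2 * B ^ 2 * L ^ 2 * ‖(m : ℂ) - φ‖ := by
      rw [div_inv_eq_mul]
      ring
    rw [h5]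
    calc (2 * B ^ 2 * L ^ 2 * ‖(m : ℂ) - φ‖ + |η|⁻¹) ^ 2
        ≤ 2 * ((2 * B ^ 2 * L ^ 2 * ‖(m : ℂ) - φ‖) ^ 2 + |η|⁻¹ ^ 2) := add_sq_le
      _ ≤ 2 * ((2 * B ^ 2 * L ^ 2 * ‖(m : ℂ) - φ‖) ^ 2 + 17 * B ^ 2 * (1 + η ^ 2)⁻¹) := by
          gcongr
      _ ≤ _ := by
          have h6 : B ^ 2 * (1 + η ^ 2)⁻¹ ≤ B ^ 4 * (1 + η ^ 2)⁻¹ := by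
            gcongr
            nlinarith
          nlinarith

/-! ### The explicit constant and the L² estimate -/

/-- The constant in the rate of convergence. -/
def rateConstant (A B : ℝ) : ℝ :=
  1 + 100 * B ^ 4 + 8 * B ^ 4 * (800 * B ^ 3 * (A ^ 2 + 1)) ^ 4 * A ^ 2

/-- The square of a formula. -/
def ExplicitFormula.square (u : ExplicitFormula) : ExplicitFormula := .mul u u

/-- A closed formula for the constant in the rate of convergence. -/
def rateFormula : ExplicitFormula :=
  .add (.add (.const 1) (.mul (.const 100) (.square (.square .b))))
    (.mul (.mul (.mul (.const 8) (.square (.square .b)))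
      (.square (.square (.mul (.mul (.const 800) (.mul .b (.square .b)))
        (.add (.square .a) (.const 1)))))) (.square .a))

theorem eval_rateFormula (A B : ℝ) : rateFormula.eval A B = rateConstant A B := by
  simp only [rateFormula, ExplicitFormula.square, ExplicitFormula.eval, rateConstant]
  push_cast
  ring

theorem rateConstant_pos (A B : ℝ) : 0 < rateConstant A B := by
  have h1 : 0 ≤ B ^ 4 := by positivity
  have h2 : 0 ≤ (800 * B ^ 3 * (A ^ 2 + 1)) ^ 4 := by positivity
  rw [rateConstant]
  positivity

theorem rateConstant_mono {A A' B B' : ℝ} (hA : 0 ≤ A) (hAA' : A ≤ A') (hB : 0 ≤ B)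
    (hBB' : B ≤ B') : rateConstant A B ≤ rateConstant A' B' := by
  have hA' := hA.trans hAA'
  have hB' := hB.trans hBB'
  rw [rateConstant, rateConstant]
  gcongr

theorem IsMildSolution.halfFourier_eq {k : ℝ} {f₀ : WeightedL1 k} {f : ℝ → WeightedL1 k}
    (hk : 0 ≤ k) (h : IsMildSolution (fun _ _ => 2) f₀ f) {t : ℝ} (ht : 0 ≤ t) (w m : ℝ)
    (hm : halfFourier f₀ 0 = m) (hm0 : 0 ≤ m) (hφ : 0 ≤ (m - halfFourier f₀ w).re) :
    halfFourier (f t) (Real.exp t * w) = Real.exp t * m / (1 + (Real.exp t - 1) * m) -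
      Real.exp t * (m - halfFourier f₀ w) /
        (1 + (Real.exp t - 1) * (m - halfFourier f₀ w)) := by
  have h1 := h.halfFourier_zero_riccati hk ht
  have h2 := h.halfFourier_riccati hk ht w
  have ha : 0 ≤ Real.exp t - 1 := sub_nonneg.2 (Real.one_le_exp ht)
  rw [hm, Real.exp_neg] at h1 h2
  set φ : ℂ := m - halfFourier f₀ w
  have hne1 : (1 + (Real.exp t - 1) * m : ℂ) ≠ 0 := by
    have : (0 : ℝ) < 1 + (Real.exp t - 1) * m := by positivity
    exact_mod_cast this.ne'
  have hne2 : (1 + (Real.exp t - 1) * φ : ℂ) ≠ 0 := by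
    have h3 := one_add_mul_re_le_norm φ (Real.exp t - 1)
    have h4 : 0 < 1 + (Real.exp t - 1) * φ.re := by positivity
    have := norm_pos_iff.1 (h4.trans_le h3)
    push_cast at this ⊢
    exact this
  have hinv : (Real.exp t : ℂ) * ((Real.exp t)⁻¹ : ℝ) = 1 := by
    rw [← Complex.ofReal_mul, mul_inv_cancel₀ (Real.exp_pos t).ne', Complex.ofReal_one]
  have e1 : halfFourier (f t) 0 = Real.exp t * m / (1 + (Real.exp t - 1) * m) := by
    rw [eq_div_iff hne1]
    linear_combination (Real.exp t : ℂ) * h1 -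
      halfFourier (f t) 0 * (1 + (Real.exp t - 1) * m) * hinv
  have e2 : halfFourier (f t) 0 - halfFourier (f t) (Real.exp t * w) =
      Real.exp t * φ / (1 + (Real.exp t - 1) * φ) := by
    rw [eq_div_iff hne2]
    linear_combination (Real.exp t : ℂ) * h2 - (halfFourier (f t) 0 -
      halfFourier (f t) (Real.exp t * w)) * (1 + (Real.exp t - 1) * φ) * hinv
  rw [← e1, ← e2]
  ring

theorem eLpNorm_sub_exp_neg_le {k : ℝ} {f₀ : WeightedL1 k} {f : ℝ → WeightedL1 k} {A B : ℝ}
    (hk : 0 ≤ k) (h : IsMildSolution (fun _ _ => 2) f₀ f) (hb : HasMomentBounds f₀ A B)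
    (hA0 : 0 ≤ A) (h2 : MemLp f₀ 2 halfLine) (hA : eLpNorm f₀ 2 halfLine = ENNReal.ofReal A)
    {t : ℝ} (ht : 0 ≤ t) : eLpNorm (fun x => f t x - Real.exp (-x)) 2 halfLine ≤
      ENNReal.ofReal (rateConstant A B * Real.exp (-t / 2)) := by
  have hB := hb.one_le
  have hi := WeightedL1.integrable hk (f t)
  have hπ := Real.pi_pos
  set K₁ := 200 * B ^ 4 with hK₁
  set K₂ := 8 * B ^ 4 * (800 * B ^ 3 * (A ^ 2 + 1)) ^ 4 with hK₂
  have hK₁0 : 0 ≤ K₁ := by positivity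
  have hK₂0 : 0 ≤ K₂ := by positivity
  set a := Real.exp t with ha
  have ha0 : 0 < a := Real.exp_pos t
  set H : ℝ → ℝ := fun η => (K₁ * (1 + η ^ 2)⁻¹ + K₂ * ‖halfFourier f₀ η‖ ^ 2) * (a ^ 2)⁻¹ with hH
  have hpt : ∀ ξ : ℝ, ‖halfFourier (fun x => f t x - Real.exp (-x)) ξ‖ₑ ^ 2 ≤
      ENNReal.ofReal (H (a⁻¹ * ξ)) := by
    intro ξ
    set η := a⁻¹ * ξ with hη
    have hξ : ξ = a * η := by rw [hη, mul_inv_cancel_left₀ ha0.ne']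
    have hm : halfFourier f₀ 0 = (∫ x, f₀ x ∂halfLine : ℝ) := halfFourier_zero _
    set m := ∫ x, f₀ x ∂halfLine
    have hm1 := hb.inv_le_integral
    have hφ := hb.re_halfFourier_zero_sub_nonneg η
    have hφ1 := hb.norm_halfFourier_zero_sub_le η
    have hφ2 := hb.norm_halfFourier_zero_sub_sub_le η
    have hφ3 : (4 * B)⁻¹ ≤ |η| → _ := fun hη => hb.inv_le_integral_one_sub_cos hη
    rw [← re_halfFourier_zero_sub hb.integrable] at hφ3
    rw [hm] at hφ hφ1 hφ2 hφ3
    have hsq := sq_norm_explicit_sub_profile_le (Real.one_le_exp ht) hB hm1 hb.integral_le hφ hφ1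
      hφ2 hφ3
    rw [halfFourier_sub hi integrable_exp_neg, halfFourier_exp_neg, hξ,
      h.halfFourier_eq hk ht η m hm (le_trans (by positivity) hm1) hφ, ← ofReal_norm,
      ← ENNReal.ofReal_pow (norm_nonneg _)]
    refine ENNReal.ofReal_le_ofReal (hsq.trans_eq ?_)
    rw [sub_sub_cancel]
  have hFm : Measurable fun η => ‖halfFourier f₀ η‖ₑ ^ 2 := by
    have : Continuous (halfFourier f₀) := by
      have h3 := continuous_fourier_of_integrable (integrable_indicator_ofReal hb.integrable)
      have h4 : halfFourier f₀ =
          fun ξ => FourierTransform.fourier (indicator (Ioi 0) fun x => (f₀ x : ℂ))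
            ((2 * Real.pi)⁻¹ * ξ) := by
        ext ξ
        rw [← halfFourier_two_pi_mul, mul_inv_cancel_left₀ Real.two_pi_pos.ne']
      rw [h4]
      exact h3.comp (by fun_prop)
    exact (this.enorm.measurable).pow_const 2
  -- The integral of 1/(1+η²) is π, and that of |f̂₀|² is 2πA² by Plancherel.
  have hHint : ∫⁻ η, ENNReal.ofReal (H η) =
      ENNReal.ofReal (2 * Real.pi) * ENNReal.ofReal ((K₁ / 2 + K₂ * A ^ 2) * (a ^ 2)⁻¹) := by
    have e1 : ∀ η, ENNReal.ofReal (H η) = ENNReal.ofReal (K₁ * (a ^ 2)⁻¹ * (1 + η ^ 2)⁻¹) +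
        ENNReal.ofReal (K₂ * (a ^ 2)⁻¹) * ‖halfFourier f₀ η‖ₑ ^ 2 := fun η => by
      rw [← ofReal_norm, ← ENNReal.ofReal_pow (norm_nonneg _), ← ENNReal.ofReal_mul (by positivity),
        ← ENNReal.ofReal_add (by positivity) (by positivity), hH]
      ring_nf
    simp_rw [e1]
    rw [lintegral_add_right _ (hFm.const_mul _), lintegral_const_mul _ hFm,
      lintegral_halfFourier_sq_of_memLp hb.integrable h2, hA, ← ofReal_integral_eq_lintegral_ofReal
      (integrable_inv_one_add_sq.const_mul _) (ae_of_all _ fun η => by positivity),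
      integral_const_mul, integral_univ_inv_one_add_sq, ← ENNReal.ofReal_pow hA0,
      ← ENNReal.ofReal_mul (by positivity), ← ENNReal.ofReal_mul (by positivity),
      ← ENNReal.ofReal_add (by positivity) (by positivity), ← ENNReal.ofReal_mul (by positivity)]
    congr 1
    ring
  have hle : ∫⁻ ξ, ‖halfFourier (fun x => f t x - Real.exp (-x)) ξ‖ₑ ^ 2 ≤
      ENNReal.ofReal (2 * Real.pi) * ENNReal.ofReal ((K₁ / 2 + K₂ * A ^ 2) * a⁻¹) := by
    refine (lintegral_mono hpt).trans_eq ?_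
    have h3 := lintegral_comp_mul_left_real (fun η => ENNReal.ofReal (H η)) (inv_pos.2 ha0)
    rw [hHint] at h3
    have h4 : ENNReal.ofReal a * ENNReal.ofReal a⁻¹ = 1 := by
      rw [← ENNReal.ofReal_mul ha0.le, mul_inv_cancel₀ ha0.ne', ENNReal.ofReal_one]
    rw [← one_mul (∫⁻ ξ, _), ← h4, mul_assoc, h3, ← ENNReal.ofReal_mul (by positivity),
      ← ENNReal.ofReal_mul (by positivity), ← ENNReal.ofReal_mul (by positivity)]
    congr 1
    field_simp
  -- Finiteness in frequency is what places f(t) - G⁰ in L².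
  have hlt : ∫⁻ ξ, ‖halfFourier (fun x => f t x - Real.exp (-x)) ξ‖ₑ ^ 2 < ⊤ :=
    hle.trans_lt (ENNReal.mul_lt_top ENNReal.ofReal_lt_top ENNReal.ofReal_lt_top)
  rw [lintegral_halfFourier_sq_of_lt_top (g := fun x => f t x - Real.exp (-x))
    (hi.sub integrable_exp_neg) hlt,
    ENNReal.mul_le_mul_iff_right (by simpa using Real.pi_pos) ENNReal.ofReal_ne_top] at hle
  rw [← ENNReal.pow_le_pow_left_iff two_ne_zero]
  refine hle.trans ?_
  rw [← ENNReal.ofReal_pow (mul_nonneg (rateConstant_pos A B).le (Real.exp_pos _).le)]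
  refine ENNReal.ofReal_le_ofReal ?_
  have e2 : a⁻¹ = Real.exp (-t / 2) ^ 2 := by
    rw [ha, ← Real.exp_neg, ← Real.exp_nat_mul]
    ring_nf
  -- The summand 1 avoids a square root in the formula: X ≤ (1 + X)² for X ≥ 0.
  have e3 : rateConstant A B = 1 + (K₁ / 2 + K₂ * A ^ 2) := by
    rw [rateConstant, hK₁, hK₂]
    ring
  rw [mul_pow, e2, e3]
  gcongr
  have : 0 ≤ K₁ / 2 + K₂ * A ^ 2 := by positivity
  nlinarith

theorem integral_sq_eq_toReal_eLpNorm {g : ℝ → ℝ} (h2 : MemLp g 2 halfLine) :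
    ∫ x, g x ^ 2 ∂halfLine = (eLpNorm g 2 halfLine).toReal ^ 2 := by
  rw [← ENNReal.toReal_pow, eLpNorm_two_sq, integral_eq_lintegral_of_nonneg_ae
    (ae_of_all _ fun x => sq_nonneg _) (h2.1.pow 2)]
  congr 2 with x
  rw [← ofReal_norm, ← ENNReal.ofReal_pow (norm_nonneg _), Real.norm_eq_abs, sq_abs]

theorem hasMomentBounds_of_isUnitMassDensity {g : ℝ → ℝ} (hg : Integrable g halfLine)
    (h : IsUnitMassDensity g) (h2 : MemLp g 2 halfLine)
    (hsq : Integrable (fun x => x ^ 2 * g x) halfLine) :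
    HasMomentBounds g (normL2 g) (normL1 2 g) := by
  -- Expanding (1 + x)² with unit mass shows that the norm is at least 2, hence the bound `one_le`,
  -- and that it dominates both moments.
  have hB : normL1 2 g = (∫ x, g x ∂halfLine) + (2 + ∫ x, x ^ 2 * g x ∂halfLine) := by
    have i2 : Integrable (fun x => 2 * (x * g x)) halfLine := h.2.1.const_mul 2
    have i3 : Integrable (fun x => 2 * (x * g x) + x ^ 2 * g x) halfLine := i2.add hsq
    have e : ∫ x, 2 * (x * g x) ∂halfLine = 2 := by rw [integral_const_mul, h.2.2, mul_one]
    suffices e' : normL1 2 g = ∫ x, g x + (2 * (x * g x) + x ^ 2 * g x) ∂halfLine by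
      rw [e', integral_add hg i3, integral_add i2 hsq, e]
    refine integral_congr_ae ?_
    filter_upwards [h.1] with x hx
    rw [abs_of_nonneg hx, Real.rpow_two]
    ring
  have hm : 0 ≤ ∫ x, g x ∂halfLine := integral_nonneg_of_ae h.1
  have hM : 0 ≤ ∫ x, x ^ 2 * g x ∂halfLine := by
    refine integral_nonneg_of_ae ?_
    filter_upwards [h.1] with x hx using mul_nonneg (sq_nonneg x) hx
  exact
    { nonneg := h.1
      integrable := hg
      integrable_mul := h.2.1
      integral_mul := h.2.2
      integrable_sq_mul := hsq
      integrable_sq := h2.integrable_sq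
      integral_sq_le := (integral_sq_eq_toReal_eLpNorm h2).le
      one_le := by linarith
      integral_le := by linarith
      integral_sq_mul_le := by linarith }

end

theorem theorem2p9 :
    -- `e^{-x}` is the unique self-similar profile with total mass one, for the kernel `K = 2`
    (∃ G₀ : WeightedL1 1, (G₀ =ᵐ[halfLine] fun x => Real.exp (-x)) ∧
      IsProfile (fun _ _ => 2) G₀ ∧ IsUnitMassDensity G₀ ∧
      ∀ G : WeightedL1 1, IsProfile (fun _ _ => 2) G → IsUnitMassDensity G → G = G₀) ∧
    -- convergence to it, with a constant depending on the two norms of the initial datum only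
    ∃ C : ℝ → ℝ → ℝ,
      (∃ F : ExplicitFormula, ∀ A B : ℝ, 0 ≤ A → 0 ≤ B → C A B = F.eval A B) ∧
      (∀ A B : ℝ, 0 ≤ A → 0 ≤ B → 0 < C A B) ∧
      (∀ A A' B B' : ℝ, 0 ≤ A → A ≤ A' → 0 ≤ B → B ≤ B' → C A B ≤ C A' B') ∧
      ∀ (k : ℝ), 0 ≤ k → ∀ (f₀ : WeightedL1 k) (f : ℝ → WeightedL1 k),
        IsMildSolution (fun _ _ => 2) f₀ f →
        IsUnitMassDensity f₀ →
        MemLp f₀ 2 halfLine →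
        Integrable (fun x => x ^ 2 * f₀ x) halfLine →
        ∀ t : ℝ, 0 ≤ t →
          eLpNorm (fun x => f t x - Real.exp (-x)) 2 halfLine ≤
            ENNReal.ofReal (C (normL2 f₀) (normL1 2 f₀) * Real.exp (-t / 2)) := by
  refine ⟨⟨expProfile, expProfile_ae_eq, isProfile_expProfile, isUnitMassDensity_expProfile,
    fun G hG hu => eq_expProfile_of_isProfile hG hu⟩, rateConstant,
    ⟨rateFormula, fun A B _ _ => (eval_rateFormula A B).symm⟩, fun A B _ _ => rateConstant_pos A B,
    fun A A' B B' hA hAA' hB hBB' => rateConstant_mono hA hAA' hB hBB', ?_⟩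
  intro k hk f₀ f h hu h2 hsq t ht
  exact eLpNorm_sub_exp_neg_le hk h
    (hasMomentBounds_of_isUnitMassDensity (WeightedL1.integrable hk f₀) hu h2 hsq)
    ENNReal.toReal_nonneg h2 (ENNReal.ofReal_toReal h2.2.ne).symm ht
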